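/- Let $\widetilde G=(G,U(\mathbb Q),\varphi)$ be a quaternion unit gain graph: $G$ is a finite simple graph, $\mathbb Q$ denotes the real quaternions, $U(\mathbb Q)=\{q\in\mathbb Q:|q|=1\}$, and $\varphi$ assigns to each oriented edge $uv$ of $G$ a gain $\varphi_{uv}\in U(\mathbb Q)$ with $\varphi_{vu}=\varphi_{uv}^{-1}$. Its adjacency matrix has entry $\varphi_{uv}$ at $(u,v)$ if $uv$ is an edge and $0$ otherwise, and its rank $r(\widetilde G)$ is the left row rank of this matrix, i.e. the maximum number of rows that are left linearly independent over $\mathbb Q$. The graph is bicyclic if it is connected and has one more edge than vertices; a pendant vertex is a vertex of degree $1$; pendant twins are two distinct pendant vertices with the same neighbor. The gain of a cycle $C=v_1v_2\cdots v_nv_1$ ($n\ge 3$) is $\varphi(C)=\varphi_{v_1v_2}\cdots\varphi_{v_{n-1}v_n}\varphi_{v_nv_1}$; $C$ is of Type 1 if $n$ is even and $\varphi(C)=(-1)^{n/2}$, and of Type 4 if $n$ is odd and $\mathrm{Re}\big((-1)^{(n-1)/2}\varphi(C)\big)=0$. Define graphs $G_{12},\dots,G_{22}$, each on the vertex set $\{1,\dots,m\}$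 where $m$ is the largest label occurring, by their edges as follows. Let $D=\{12,23,34,41,24\}$ and $K=\{12,23,34,41,25,45\}$. - $G_{12}$: $12,13,23,24,34,45$. - $G_{13}$: $D\cup\{25\}$. - $G_{14}$: $D\cup\{25,46\}$. - $G_{15}$: $D\cup\{15,56\}$. - $G_{16}$: $D\cup\{25,56\}$. - $G_{17}$: $12,23,34,41,15,25,56$. - $G_{18}$: $K\cup\{56\}$. - $G_{19}$: $K\cup\{26\}$. - $G_{20}$: $K\cup\{26,47\}$. - $G_{21}$: $K\cup\{16,67\}$. - $G_{22}$: $K\cup\{26,67\}$. **Theorem 4.5.** $\widetilde G$ is a connected bicyclic gain graph with at least one pendant vertex, without pendant twins, and with $r(\widetilde G)=4$, if and only if, for some $k\in\{12,\dots,22\}$, there is an isomorphism from $G_k$ onto $G$ such that, with the vertices of $G$ labelled through it, the following gain condition holds: - $k=12$: the cycle $1\,2\,3\,1$ is of Type 4; - $k\in\{13,14,19,20\}$: no condition; - $k\in\{15,16\}$: the cycle $1\,2\,4\,1$ is of Type 4 and the cycle $1\,2\,3\,4\,1$ is of Type 1; - $k\in\{17,18\}$: the cycle $1\,2\,3\,4\,1$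 is of Type 1; - $k\in\{21,22\}$: the cycles $1\,2\,5\,4\,1$ and $1\,2\,3\,4\,1$ are of Type 1. -/

import Mathlib

open scoped Quaternion

/-- A gain graph with gain group `U(ℍ) = {q : |q| = 1}`: a simple graph together with a gain on
every oriented edge, reversing an oriented edge inverting its gain. -/
structure QuatGainGraph (V : Type*) where
  graph : SimpleGraph V
  gain : graph.Dart → Metric.sphere (0 : ℍ[ℝ]) 1
  gain_symm : ∀ d : graph.Dart, gain d.symm = (gain d)⁻¹

namespace QuatGainGraph

variable {V : Type*}

open Classical in
/-- The adjacency matrix: the entry at `(u, v)` is the gain of the oriented edge from `u` to `v`,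
and `0` when `u` and `v` are not adjacent. -/
noncomputable def adjMatrix (Φ : QuatGainGraph V) : Matrix V V ℍ[ℝ] :=
  Matrix.of fun u v => if h : Φ.graph.Adj u v then (Φ.gain ⟨(u, v), h⟩ : ℍ[ℝ]) else 0

/-- The rank: the left row rank of the adjacency matrix, that is, the maximum number of rows
that are left linearly independent over the quaternions. -/
noncomputable def rank (Φ : QuatGainGraph V) : ℕ :=
  sSup {k : ℕ | ∃ s : Finset V, s.card = k ∧ LinearIndepOn ℍ[ℝ] Φ.adjMatrix.row (s : Set V)}

/-- The vertices `v₁, …, vₙ` of the list form, in this order, a cycle `v₁ v₂ … vₙ v₁`. -/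
def IsCycle (Φ : QuatGainGraph V) (l : List V) : Prop :=
  3 ≤ l.length ∧ l.Nodup ∧ ∀ p ∈ l.zip (l.rotate 1), Φ.graph.Adj p.1 p.2

/-- The gain `φ(v₁v₂) φ(v₂v₃) ⋯ φ(vₙ₋₁vₙ) φ(vₙv₁)` of a cycle `v₁ v₂ … vₙ v₁`. -/
noncomputable def cycleGain (Φ : QuatGainGraph V) (l : List V) : ℍ[ℝ] :=
  ((l.zip (l.rotate 1)).map fun p => Φ.adjMatrix p.1 p.2).prod

/-- Cycles of Type 1: even length `n` and gain `(-1) ^ (n / 2)`. -/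
def IsType1 (Φ : QuatGainGraph V) (l : List V) : Prop :=
  Φ.IsCycle l ∧ Even l.length ∧ Φ.cycleGain l = (-1) ^ (l.length / 2)

/-- Cycles of Type 4: odd length `n` and `Re ((-1) ^ ((n - 1) / 2) * gain) = 0`. -/
def IsType4 (Φ : QuatGainGraph V) (l : List V) : Prop :=
  Φ.IsCycle l ∧ Odd l.length ∧ ((-1) ^ ((l.length - 1) / 2) * Φ.cycleGain l).re = 0

end QuatGainGraph

/-- A bicyclic graph: a connected graph with one more edge than it has vertices. -/
def SimpleGraph.IsBicyclic {V : Type*} (G : SimpleGraph V) : Prop :=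
  G.Connected ∧ G.edgeSet.ncard = Nat.card V + 1

/-- A pendant vertex: a vertex of degree one. -/
def SimpleGraph.IsPendant {V : Type*} (G : SimpleGraph V) (v : V) : Prop :=
  (G.neighborSet v).ncard = 1

/-- Pendant twins: two distinct pendant vertices with the same neighbour. -/
def SimpleGraph.ArePendantTwins {V : Type*} (G : SimpleGraph V) (x y : V) : Prop :=
  x ≠ y ∧ G.IsPendant x ∧ G.IsPendant y ∧ G.neighborSet x = G.neighborSet y

/-- The simple graph on `Fin n` with the listed edges. -/
def graphOfEdges (n : ℕ) (E : List (Fin n × Fin n)) : SimpleGraph (Fin n) :=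
  SimpleGraph.fromRel fun a b => (a, b) ∈ E

/- The eleven graphs. The element `i` of `Fin n` is the vertex with label `i + 1`. -/

/-- `θ(0,1,1)` (two triangles sharing an edge) with a pendant vertex at a vertex of degree 2;
the triangle avoiding that vertex has the labels 1, 2, 3. -/
def graph12 : SimpleGraph (Fin 5) :=
  graphOfEdges 5 [(0, 1), (0, 2), (1, 2), (1, 3), (2, 3), (3, 4)]

/-- `θ(0,1,1)`, drawn as the 4-cycle 1 2 3 4 with the chord 24, with a pendant vertex at a
vertex of degree 3. -/
def graph13 : SimpleGraph (Fin 5) :=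
  graphOfEdges 5 [(0, 1), (1, 2), (2, 3), (3, 0), (1, 3), (1, 4)]

/-- `θ(0,1,1)` with a pendant vertex at each of the two vertices of degree 3. -/
def graph14 : SimpleGraph (Fin 6) :=
  graphOfEdges 6 [(0, 1), (1, 2), (2, 3), (3, 0), (1, 3), (1, 4), (3, 5)]

/-- `θ(0,1,1)` with a pendant path on two vertices at a vertex of degree 2. -/
def graph15 : SimpleGraph (Fin 6) :=
  graphOfEdges 6 [(0, 1), (1, 2), (2, 3), (3, 0), (1, 3), (0, 4), (4, 5)]

/-- `θ(0,1,1)` with a pendant path on two vertices at a vertex of degree 3. -/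
def graph16 : SimpleGraph (Fin 6) :=
  graphOfEdges 6 [(0, 1), (1, 2), (2, 3), (3, 0), (1, 3), (1, 4), (4, 5)]

/-- `θ(0,1,2)` (a 4-cycle and a triangle sharing an edge) with a pendant vertex at the vertex
of the triangle outside the 4-cycle. -/
def graph17 : SimpleGraph (Fin 6) :=
  graphOfEdges 6 [(0, 1), (1, 2), (2, 3), (3, 0), (0, 4), (1, 4), (4, 5)]

/-- `θ(1,1,1)` (the complete bipartite graph with parts `{2, 4}` and `{1, 3, 5}`) with a pendant
vertex at a vertex of degree 2. -/
def graph18 : SimpleGraph (Fin 6) :=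
  graphOfEdges 6 [(0, 1), (1, 2), (2, 3), (3, 0), (1, 4), (3, 4), (4, 5)]

/-- `θ(1,1,1)` with a pendant vertex at a vertex of degree 3. -/
def graph19 : SimpleGraph (Fin 6) :=
  graphOfEdges 6 [(0, 1), (1, 2), (2, 3), (3, 0), (1, 4), (3, 4), (1, 5)]

/-- `θ(1,1,1)` with a pendant vertex at each of the two vertices of degree 3. -/
def graph20 : SimpleGraph (Fin 7) :=
  graphOfEdges 7 [(0, 1), (1, 2), (2, 3), (3, 0), (1, 4), (3, 4), (1, 5), (3, 6)]

/-- `θ(1,1,1)` with a pendant path on two vertices at a vertex of degree 2. -/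
def graph21 : SimpleGraph (Fin 7) :=
  graphOfEdges 7 [(0, 1), (1, 2), (2, 3), (3, 0), (1, 4), (3, 4), (0, 5), (5, 6)]

/-- `θ(1,1,1)` with a pendant path on two vertices at a vertex of degree 3. -/
def graph22 : SimpleGraph (Fin 7) :=
  graphOfEdges 7 [(0, 1), (1, 2), (2, 3), (3, 0), (1, 4), (3, 4), (1, 5), (5, 6)]

/-! ### The rank and the removal of a pendant vertex with its neighbour -/

namespace QuatGainGraph

variable {V : Type*} (Φ : QuatGainGraph V)

/-! Let `v` be a pendant vertex with neighbour `u`. Row `v` is nonzero only in column `u`, and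
column `v` only in row `u`, so this pair contributes exactly 2 to the rank: the rank is 4 if and
only if the matrix on the vertices of `{u, v}ᶜ` has rank 2. For an edge `xy` there, the rows of `x`
and `y` are independent, so rank 2 means that they span all the rows; the columns of `x` and `y`
force the coefficients, and the result is the identity `SpannedBy` (`PendantAt.rank_eq_four`,
`PendantAt.spannedBy_of_rank`).

This one identity governs both gains and shape. On the diagonal it makes triangles Type 4; where
only one summand survives it makes quadrangles Type 1. A vertex adjacent to neither `x` nor `y`
would be isolated in `{u, v}ᶜ`, hence pendant at `u` and a twin of `v`. So each edge of the
remaining graph dominates it, which makes that graph connected and complete multipartite. Since the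
whole graph is bicyclic, its cyclomatic number `c` is at most 2, and only the star, the triangle,
the quadrangle, the diamond `K_{1,1,2}` and `K_{2,3}` survive. The edge count then gives `u` exactly
`3 - c` neighbours there, and the absence of twins allows a star at most one leaf not joined to `u`.
The possible attachments, up to symmetry, are the eleven graphs (`IsReduction.isListed`).

Conversely, on a listed graph the identity reads `0 = 0` or is automatic, except at one or two pairs
of vertices, where it is the gain condition (`isBicyclic_and_rank_eq_four_of_iso`). -/

lemma adjMatrix_of_adj {a b : V} (h : Φ.graph.Adj a b) :
    Φ.adjMatrix a b = (Φ.gain ⟨(a, b), h⟩ : ℍ[ℝ]) := by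
  simp [adjMatrix, h]

lemma adjMatrix_of_not_adj {a b : V} (h : ¬ Φ.graph.Adj a b) : Φ.adjMatrix a b = 0 := by
  simp [adjMatrix, h]

lemma adjMatrix_mul_symm {a b : V} (h : Φ.graph.Adj a b) :
    Φ.adjMatrix a b * Φ.adjMatrix b a = 1 := by
  have hs : Φ.gain ⟨(b, a), h.symm⟩ = (Φ.gain ⟨(a, b), h⟩)⁻¹ := Φ.gain_symm ⟨(a, b), h⟩
  rw [Φ.adjMatrix_of_adj h, Φ.adjMatrix_of_adj h.symm, hs,
    Metric.unitSphere.coe_inv, mul_inv_cancel₀ (ne_zero_of_mem_unit_sphere _)]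

lemma adjMatrix_ne_zero {a b : V} (h : Φ.graph.Adj a b) : Φ.adjMatrix a b ≠ 0 :=
  left_ne_zero_of_mul_eq_one (Φ.adjMatrix_mul_symm h)

lemma adj_of_adjMatrix_ne_zero {a b : V} (h : Φ.adjMatrix a b ≠ 0) : Φ.graph.Adj a b := by
  by_contra hn
  exact h (Φ.adjMatrix_of_not_adj hn)

lemma adjMatrix_self (a : V) : Φ.adjMatrix a a = 0 :=
  Φ.adjMatrix_of_not_adj (Φ.graph.loopless.irrefl a)

lemma star_adjMatrix (a b : V) : star (Φ.adjMatrix a b) = Φ.adjMatrix b a := by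
  by_cases h : Φ.graph.Adj a b
  · have h1 := Φ.adjMatrix_mul_symm h
    have hn : ‖Φ.adjMatrix a b‖ = 1 := by
      rw [Φ.adjMatrix_of_adj h]; exact norm_eq_of_mem_sphere _
    have h2 : Φ.adjMatrix a b * star (Φ.adjMatrix a b) = 1 := by
      rw [Quaternion.self_mul_star, Quaternion.normSq_eq_norm_mul_self, hn]; simp
    exact mul_left_cancel₀ (Φ.adjMatrix_ne_zero h) (h2.trans h1.symm)
  · rw [Φ.adjMatrix_of_not_adj h, Φ.adjMatrix_of_not_adj fun h' => h h'.symm, star_zero]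

lemma card_le_rank [Finite V] {s : Finset V}
    (hs : LinearIndepOn ℍ[ℝ] Φ.adjMatrix.row (s : Set V)) : s.card ≤ Φ.rank := by
  have := Fintype.ofFinite V
  -- The bound is essential: an unbounded set of naturals has `sSup` equal to 0.
  refine le_csSup ⟨Fintype.card V, ?_⟩ ⟨s, rfl, hs⟩
  rintro _ ⟨t, rfl, -⟩
  exact t.card_le_univ

lemma rank_le_card_of_span (s : Finset V)
    (hs : ∀ z, Φ.adjMatrix.row z ∈ Submodule.span ℍ[ℝ] (Φ.adjMatrix.row '' (s : Set V))) :
    Φ.rank ≤ s.card := by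
  classical
  refine csSup_le ⟨0, ∅, rfl, by simp⟩ ?_
  rintro _ ⟨t, rfl, ht⟩
  have h1 := linearIndependent_le_span_aux' _ ht ((s.image Φ.adjMatrix.row : Finset _) : Set (V → ℍ[ℝ])) (by
    rintro _ ⟨z, rfl⟩
    simpa using hs z)
  simp only [Finset.coe_sort_coe, Fintype.card_coe] at h1
  exact h1.trans Finset.card_image_le

/-- `v` is a pendant vertex whose neighbour is `u`. -/
def PendantAt (u v : V) : Prop := Φ.graph.neighborSet v = {u}

/-- On the vertices in `s`, every row of the adjacency matrix is the combination of the rows of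
the adjacent vertices `x` and `y` that is forced by the columns of `x` and `y`. -/
def SpannedBy (s : Set V) (x y : V) : Prop :=
  ∀ z ∈ s, ∀ w ∈ s, Φ.adjMatrix z w =
    Φ.adjMatrix z y * Φ.adjMatrix y x * Φ.adjMatrix x w +
      Φ.adjMatrix z x * Φ.adjMatrix x y * Φ.adjMatrix y w

variable {Φ}

namespace PendantAt

variable {u v : V} (h : Φ.PendantAt u v)
include h

lemma adj_iff {w : V} : Φ.graph.Adj v w ↔ w = u := by
  rw [← SimpleGraph.mem_neighborSet, h, Set.mem_singleton_iff]

lemma adj : Φ.graph.Adj v u := h.adj_iff.2 rfl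

lemma ne : u ≠ v := h.adj.ne'

lemma left_eq_zero {w : V} (hw : w ≠ u) : Φ.adjMatrix v w = 0 :=
  Φ.adjMatrix_of_not_adj fun h' => hw (h.adj_iff.1 h')

lemma right_eq_zero {w : V} (hw : w ≠ u) : Φ.adjMatrix w v = 0 :=
  Φ.adjMatrix_of_not_adj fun h' => hw (h.adj_iff.1 h'.symm)

/-- The columns of `v`, `x`, `y`, `u`, taken in this order, isolate the coefficients of the rows
`u`, `y`, `x`, `v` one at a time. -/
lemma linearIndepOn [DecidableEq V] {x y : V} (hxu : x ≠ u) (hyu : y ≠ u)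
    (hxy : Φ.graph.Adj x y) (hxv : x ≠ v) (hyv : y ≠ v) :
    LinearIndepOn ℍ[ℝ] Φ.adjMatrix.row (({u, v, x, y} : Finset V) : Set V) := by
  rw [linearIndepOn_finset_iff]
  intro g hg
  have hne := h.ne
  rw [Finset.sum_insert (by simp [hne, hxu.symm, hyu.symm]),
    Finset.sum_insert (by simp [hxv.symm, hyv.symm]),
    Finset.sum_insert (by simp [hxy.ne]), Finset.sum_singleton] at hg
  have key : ∀ w, g u * Φ.adjMatrix u w + (g v * Φ.adjMatrix v w +
      (g x * Φ.adjMatrix x w + g y * Φ.adjMatrix y w)) = 0 := fun w => congrFun hg w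
  have hu : g u = 0 := by
    have := key v
    simpa [Φ.adjMatrix_self, h.right_eq_zero hxu, h.right_eq_zero hyu,
      Φ.adjMatrix_ne_zero h.adj.symm] using this
  have hy : g y = 0 := by
    have := key x
    simpa [hu, Φ.adjMatrix_self, h.left_eq_zero hxu, Φ.adjMatrix_ne_zero hxy.symm] using this
  have hx : g x = 0 := by
    have := key y
    simpa [hu, Φ.adjMatrix_self, h.left_eq_zero hyu, Φ.adjMatrix_ne_zero hxy] using this
  have hv : g v = 0 := by
    have := key u
    simpa [hu, hx, hy, Φ.adjMatrix_ne_zero h.adj] using this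
  simp [hu, hy, hx, hv]

/-- By `SpannedBy`, row `z` minus its combination of rows `x` and `y` vanishes outside column `u`,
and a multiple of row `v` corrects that column. So the four independent rows span. -/
lemma rank_eq_four [Finite V] {x y : V} (hx : x ∈ ({u, v}ᶜ : Set V)) (hy : y ∈ ({u, v}ᶜ : Set V))
    (hxy : Φ.graph.Adj x y) (hs : Φ.SpannedBy {u, v}ᶜ x y) : Φ.rank = 4 := by
  classical
  simp only [Set.mem_compl_iff, Set.mem_insert_iff, Set.mem_singleton_iff, not_or] at hx hy
  have hne := h.ne
  have hcard : ({u, v, x, y} : Finset V).card = 4 := by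
    rw [Finset.card_insert_of_notMem (by simp [hne, Ne.symm hx.1, Ne.symm hy.1]),
      Finset.card_insert_of_notMem (by simp [Ne.symm hx.2, Ne.symm hy.2]),
      Finset.card_pair hxy.ne]
  refine le_antisymm (hcard ▸ Φ.rank_le_card_of_span _ fun z => ?_)
    (hcard ▸ Φ.card_le_rank (h.linearIndepOn hx.1 hy.1 hxy hx.2 hy.2))
  have mem : ∀ z ∈ ({u, v, x, y} : Finset V), Φ.adjMatrix.row z ∈
      Submodule.span ℍ[ℝ] (Φ.adjMatrix.row '' (({u, v, x, y} : Finset V) : Set V)) :=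
    fun z hz => Submodule.subset_span ⟨z, hz, rfl⟩
  by_cases hzu : z = u
  · exact mem z (by simp [hzu])
  by_cases hzv : z = v
  · exact mem z (by simp [hzv])
  set c := Φ.adjMatrix z y * Φ.adjMatrix y x with hc
  set d := Φ.adjMatrix z x * Φ.adjMatrix x y with hd
  have : Φ.adjMatrix.row z = c • Φ.adjMatrix.row x + d • Φ.adjMatrix.row y +
      ((Φ.adjMatrix z u - c * Φ.adjMatrix x u - d * Φ.adjMatrix y u) * Φ.adjMatrix u v) •
        Φ.adjMatrix.row v := by
    funext w
    simp only [Matrix.row, Pi.add_apply, Pi.smul_apply, smul_eq_mul]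
    by_cases hwu : w = u
    · subst hwu
      rw [mul_assoc _ (Φ.adjMatrix w v), Φ.adjMatrix_mul_symm h.adj.symm]
      simp
    by_cases hwv : w = v
    · subst hwv
      simp [h.right_eq_zero hzu, h.right_eq_zero hx.1, h.right_eq_zero hy.1, h.left_eq_zero hne.symm]
    rw [h.left_eq_zero hwu, mul_zero, add_zero]
    exact hs z (by simp [hzu, hzv]) w (by simp [hwu, hwv])
  rw [this]
  exact add_mem (add_mem (Submodule.smul_mem _ _ (mem x (by simp)))
    (Submodule.smul_mem _ _ (mem y (by simp)))) (Submodule.smul_mem _ _ (mem v (by simp)))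

/-- Without such an edge, rows `u` and `v` would span everything and the rank would be at most 2. -/
lemma exists_adj_of_rank [Finite V] (hr : Φ.rank = 4) :
    ∃ x ∈ ({u, v}ᶜ : Set V), ∃ y ∈ ({u, v}ᶜ : Set V), Φ.graph.Adj x y := by
  classical
  by_contra! hn
  have : Φ.rank ≤ ({u, v} : Finset V).card := by
    refine Φ.rank_le_card_of_span _ fun z => ?_
    have mem : ∀ z ∈ ({u, v} : Finset V), Φ.adjMatrix.row z ∈
        Submodule.span ℍ[ℝ] (Φ.adjMatrix.row '' (({u, v} : Finset V) : Set V)) :=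
      fun z hz => Submodule.subset_span ⟨z, hz, rfl⟩
    by_cases hzu : z = u
    · exact mem z (by simp [hzu])
    by_cases hzv : z = v
    · exact mem z (by simp [hzv])
    have : Φ.adjMatrix.row z = (Φ.adjMatrix z u * Φ.adjMatrix u v) • Φ.adjMatrix.row v := by
      funext w
      simp only [Matrix.row, Pi.smul_apply, smul_eq_mul]
      by_cases hwu : w = u
      · subst hwu
        rw [mul_assoc, Φ.adjMatrix_mul_symm h.adj.symm, mul_one]
      rw [h.left_eq_zero hwu, mul_zero]
      by_cases hwv : w = v
      · subst hwv
        exact h.right_eq_zero hzu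
      exact Φ.adjMatrix_of_not_adj (hn z (by simp [hzu, hzv]) w (by simp [hwu, hwv]))
    rw [this]
    exact Submodule.smul_mem _ _ (mem v (by simp))
  have := this.trans Finset.card_le_two
  omega

/-- A fifth independent row is impossible, so row `z` is a combination of the rows `u`, `v`, `x`,
`y`. Column `v` kills the coefficient of row `u`, columns `x` and `y` determine those of rows `y`
and `x`, and row `v` is invisible outside column `u`. -/
lemma spannedBy_of_rank [Finite V] (hr : Φ.rank = 4) {x y : V} (hx : x ∈ ({u, v}ᶜ : Set V))
    (hy : y ∈ ({u, v}ᶜ : Set V)) (hxy : Φ.graph.Adj x y) : Φ.SpannedBy {u, v}ᶜ x y := by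
  classical
  intro z hz w hw
  simp only [Set.mem_compl_iff, Set.mem_insert_iff, Set.mem_singleton_iff, not_or] at hx hy hz hw
  have hne := h.ne
  by_cases hzx : z = x
  · subst hzx
    simp [Φ.adjMatrix_mul_symm hxy, Φ.adjMatrix_self]
  by_cases hzy : z = y
  · subst hzy
    simp [Φ.adjMatrix_mul_symm hxy.symm, Φ.adjMatrix_self]
  have hcard : ({u, v, x, y} : Finset V).card = 4 := by
    rw [Finset.card_insert_of_notMem (by simp [hne, Ne.symm hx.1, Ne.symm hy.1]),
        Finset.card_insert_of_notMem (by simp [Ne.symm hx.2, Ne.symm hy.2]),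
        Finset.card_pair hxy.ne]
  have hli := h.linearIndepOn hx.1 hy.1 hxy hx.2 hy.2
  have hmem : Φ.adjMatrix.row z ∈
      Submodule.span ℍ[ℝ] (Φ.adjMatrix.row '' (({u, v, x, y} : Finset V) : Set V)) := by
    by_contra hn
    have h5 := hli.insert hn
    rw [← Finset.coe_insert] at h5
    have := Φ.card_le_rank h5
    rw [Finset.card_insert_of_notMem (by simp [hz, hzx, hzy]), hcard] at this
    omega
  simp only [Finset.coe_insert, Finset.coe_singleton, Set.image_insert_eq, Set.image_singleton,
    Submodule.mem_span_insert, Submodule.mem_span_singleton] at hmem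
  obtain ⟨a, _, ⟨b, _, ⟨c, _, ⟨d, rfl⟩, rfl⟩, rfl⟩, hE⟩ := hmem
  have key : ∀ w, Φ.adjMatrix z w = a * Φ.adjMatrix u w + (b * Φ.adjMatrix v w +
      (c * Φ.adjMatrix x w + d * Φ.adjMatrix y w)) := fun w => congrFun hE w
  have ha : a = 0 := by
    have := key v
    simpa [Φ.adjMatrix_self, h.right_eq_zero hx.1, h.right_eq_zero hy.1, h.right_eq_zero hz.1,
      Φ.adjMatrix_ne_zero h.adj.symm] using this
  have hd : Φ.adjMatrix z x = d * Φ.adjMatrix y x := by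
    simpa [ha, Φ.adjMatrix_self, h.left_eq_zero hx.1] using key x
  have hc : Φ.adjMatrix z y = c * Φ.adjMatrix x y := by
    simpa [ha, Φ.adjMatrix_self, h.left_eq_zero hy.1] using key y
  rw [hc, hd, mul_assoc c, mul_assoc d, Φ.adjMatrix_mul_symm hxy, Φ.adjMatrix_mul_symm hxy.symm]
  simpa [ha, h.left_eq_zero hw.1] using key w

end PendantAt

end QuatGainGraph

/-! ### Cycle types as matrix identities -/

namespace QuatGainGraph

variable {V : Type*} {Φ : QuatGainGraph V}

lemma isCycle_triple_iff {a b c : V} :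
    Φ.IsCycle [a, b, c] ↔ Φ.graph.Adj a b ∧ Φ.graph.Adj b c ∧ Φ.graph.Adj c a := by
  simp only [IsCycle, List.length_cons, List.length_nil, List.rotate_cons_succ, List.rotate_zero,
    List.cons_append, List.nil_append, List.zip_cons_cons, List.zip_nil_right, List.forall_mem_cons]
  constructor
  · rintro ⟨-, -, h1, h2, h3, -⟩
    exact ⟨h1, h2, h3⟩
  · rintro ⟨h1, h2, h3⟩
    refine ⟨le_rfl, ?_, h1, h2, h3, by simp⟩
    simp [h1.ne, h2.ne, h3.ne.symm]

lemma isCycle_quadruple_iff {a b c d : V} :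
    Φ.IsCycle [a, b, c, d] ↔ a ≠ c ∧ b ≠ d ∧
      Φ.graph.Adj a b ∧ Φ.graph.Adj b c ∧ Φ.graph.Adj c d ∧ Φ.graph.Adj d a := by
  simp only [IsCycle, List.length_cons, List.length_nil, List.rotate_cons_succ, List.rotate_zero,
    List.cons_append, List.nil_append, List.zip_cons_cons, List.zip_nil_right, List.forall_mem_cons]
  constructor
  · rintro ⟨-, hn, h1, h2, h3, h4, -⟩
    simp only [List.nodup_cons, List.mem_cons, not_or] at hn
    exact ⟨hn.1.2.1, hn.2.1.2.1, h1, h2, h3, h4⟩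
  · rintro ⟨hac, hbd, h1, h2, h3, h4⟩
    refine ⟨by norm_num, ?_, h1, h2, h3, h4, by simp⟩
    simp [h1.ne, h2.ne, h3.ne, h4.ne.symm, hac, hbd]

lemma _root_.Quaternion.re_mul_rotate (p q r : ℍ[ℝ]) : (p * (q * r)).re = (r * p * q).re := by
  simp only [Quaternion.re_mul, Quaternion.imI_mul, Quaternion.imJ_mul, Quaternion.imK_mul]
  ring

/-- A triangle is of Type 4 if and only if the rows of its vertices are dependent. -/
lemma isType4_triple_iff {a b c : V} : Φ.IsType4 [a, b, c] ↔
    (Φ.graph.Adj a b ∧ Φ.graph.Adj b c ∧ Φ.graph.Adj c a) ∧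
      Φ.adjMatrix c b * Φ.adjMatrix b a * Φ.adjMatrix a c +
        Φ.adjMatrix c a * Φ.adjMatrix a b * Φ.adjMatrix b c = 0 := by
  rw [IsType4, isCycle_triple_iff]
  refine and_congr_right fun hc => ?_
  have hodd : Odd [a, b, c].length := ⟨1, rfl⟩
  have hg : Φ.cycleGain [a, b, c] = Φ.adjMatrix a b * (Φ.adjMatrix b c * Φ.adjMatrix c a) := by
    simp [cycleGain]
  -- The two summands are the gains of the triangle in its two directions, hence conjugate, and
  -- their sum is twice a real part. The real part does not depend on the starting vertex.
  have hst : Φ.adjMatrix c b * Φ.adjMatrix b a * Φ.adjMatrix a c =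
      star (Φ.adjMatrix c a * Φ.adjMatrix a b * Φ.adjMatrix b c) := by
    simp [star_mul, star_adjMatrix, mul_assoc]
  have h1 : ([a, b, c].length - 1) / 2 = 1 := by simp
  rw [hst, add_comm, Quaternion.self_add_star', and_iff_right hodd, hg, h1,
    pow_one, neg_one_mul, Quaternion.re_neg, Quaternion.re_mul_rotate]
  generalize Φ.adjMatrix c a * Φ.adjMatrix a b * Φ.adjMatrix b c = q
  have h0 (r : ℝ) : (r : ℍ[ℝ]) = 0 ↔ r = 0 := by
    rw [← Quaternion.coe_zero, Quaternion.coe_inj]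
  rw [h0]
  simp

/-- A quadrangle is of Type 1 if and only if the rows of its first and third vertices agree up to
a factor in the columns of the second and fourth ones. -/
lemma isType1_quadruple_iff {a b c d : V} : Φ.IsType1 [a, b, c, d] ↔
    (a ≠ c ∧ b ≠ d ∧ Φ.graph.Adj a b ∧ Φ.graph.Adj b c ∧ Φ.graph.Adj c d ∧ Φ.graph.Adj d a) ∧
      Φ.adjMatrix c d = Φ.adjMatrix c b * Φ.adjMatrix b a * Φ.adjMatrix a d := by
  rw [IsType1, isCycle_quadruple_iff]
  refine and_congr_right fun hc => ?_
  obtain ⟨-, -, h1, h2, h3, h4⟩ := hc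
  have heven : Even [a, b, c, d].length := ⟨2, rfl⟩
  have hg : Φ.cycleGain [a, b, c, d] =
      Φ.adjMatrix a b * (Φ.adjMatrix b c * (Φ.adjMatrix c d * Φ.adjMatrix d a)) := by
    simp [cycleGain]
  have hl : [a, b, c, d].length / 2 = 2 := by simp
  rw [and_iff_right heven, hg, hl, neg_one_sq]
  constructor
  · intro h
    calc Φ.adjMatrix c d = Φ.adjMatrix c b * (Φ.adjMatrix b a * Φ.adjMatrix a b) *
          Φ.adjMatrix b c * Φ.adjMatrix c d * (Φ.adjMatrix d a * Φ.adjMatrix a d) := by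
            rw [Φ.adjMatrix_mul_symm h1.symm, Φ.adjMatrix_mul_symm h4, mul_one,
              mul_one, Φ.adjMatrix_mul_symm h2.symm, one_mul]
      _ = Φ.adjMatrix c b * Φ.adjMatrix b a * (Φ.adjMatrix a b *
          (Φ.adjMatrix b c * (Φ.adjMatrix c d * Φ.adjMatrix d a))) * Φ.adjMatrix a d := by
            simp only [mul_assoc]
      _ = _ := by rw [h, mul_one]
  · intro h
    calc Φ.adjMatrix a b * (Φ.adjMatrix b c * (Φ.adjMatrix c d * Φ.adjMatrix d a)) =
          Φ.adjMatrix a b * ((Φ.adjMatrix b c * Φ.adjMatrix c b) * Φ.adjMatrix b a) *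
            (Φ.adjMatrix a d * Φ.adjMatrix d a) := by rw [h]; simp only [mul_assoc]
      _ = 1 := by
        rw [Φ.adjMatrix_mul_symm h2, one_mul, Φ.adjMatrix_mul_symm h1,
          Φ.adjMatrix_mul_symm h4.symm, one_mul]

namespace SpannedBy

variable {s : Set V} {x y : V}

lemma isType4 (h : Φ.SpannedBy s x y) {z : V} (hz : z ∈ s) (hxy : Φ.graph.Adj x y)
    (hyz : Φ.graph.Adj y z) (hzx : Φ.graph.Adj z x) : Φ.IsType4 [x, y, z] :=
  isType4_triple_iff.2 ⟨⟨hxy, hyz, hzx⟩, by rw [← h z hz z hz, Φ.adjMatrix_self]⟩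

lemma isType1 (h : Φ.SpannedBy s x y) {z w : V} (hz : z ∈ s) (hw : w ∈ s) (hxz : x ≠ z)
    (hyw : y ≠ w) (hxy : Φ.graph.Adj x y) (hyz : Φ.graph.Adj y z) (hzw : Φ.graph.Adj z w)
    (hwx : Φ.graph.Adj w x) (hn : ¬ Φ.graph.Adj z x) : Φ.IsType1 [x, y, z, w] := by
  refine isType1_quadruple_iff.2 ⟨⟨hxz, hyw, hxy, hyz, hzw, hwx⟩, ?_⟩
  rw [h z hz w hw, Φ.adjMatrix_of_not_adj hn]
  simp

/-- Only one summand survives, so row `z` is a nonzero multiple of row `x` and has the same support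
in `s`. -/
lemma adj_iff_of_not_adj_left (h : Φ.SpannedBy s x y) {z w : V} (hz : z ∈ s) (hw : w ∈ s)
    (hxy : Φ.graph.Adj x y) (hzx : ¬ Φ.graph.Adj z x) (hzy : Φ.graph.Adj z y) :
    Φ.graph.Adj z w ↔ Φ.graph.Adj x w := by
  have := h z hz w hw
  rw [Φ.adjMatrix_of_not_adj hzx, zero_mul, zero_mul, add_zero] at this
  constructor
  · intro h'
    have := this ▸ Φ.adjMatrix_ne_zero h'
    exact Φ.adj_of_adjMatrix_ne_zero (right_ne_zero_of_mul this)
  · intro h'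
    refine Φ.adj_of_adjMatrix_ne_zero ?_
    rw [this]
    exact mul_ne_zero (mul_ne_zero (Φ.adjMatrix_ne_zero hzy) (Φ.adjMatrix_ne_zero hxy.symm))
      (Φ.adjMatrix_ne_zero h')

lemma not_adj (h : Φ.SpannedBy s x y) {z w : V} (hz : z ∈ s) (hw : w ∈ s)
    (hzx : ¬ Φ.graph.Adj z x) (hzy : ¬ Φ.graph.Adj z y) : ¬ Φ.graph.Adj z w := fun h' => by
  refine Φ.adjMatrix_ne_zero h' ?_
  rw [h z hz w hw, Φ.adjMatrix_of_not_adj hzx, Φ.adjMatrix_of_not_adj hzy]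
  simp

end SpannedBy

end QuatGainGraph

/-! ### Counting edges in a bicyclic graph -/

namespace SimpleGraph

variable {V : Type*} (G : SimpleGraph V)

/-- The edges of `G` with both ends in `S`. -/
def edgesWithin (S : Set V) : Set (Sym2 V) := {e ∈ G.edgeSet | ∀ a ∈ e, a ∈ S}

/-- The number of edges within `S` exceeds the number of vertices in `S` by at least `k - 1`. -/
def CyclomaticAtLeast (S : Finset V) (k : ℕ) : Prop :=
  S.card + k ≤ (G.edgesWithin S).ncard + 1

variable {G}

lemma mk_mem_edgesWithin {S : Set V} {a b : V} :
    s(a, b) ∈ G.edgesWithin S ↔ G.Adj a b ∧ a ∈ S ∧ b ∈ S := by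
  simp [edgesWithin]

lemma cyclomaticAtLeast_singleton (a : V) : G.CyclomaticAtLeast {a} 0 := by
  simp [CyclomaticAtLeast]

lemma ncard_edgesWithin_add_le [Finite V] [DecidableEq V] {S : Finset V} {w : V} (hw : w ∉ S)
    {N : Finset V} (hN : ∀ a ∈ N, a ∈ S ∧ G.Adj w a) :
    (G.edgesWithin S).ncard + N.card ≤ (G.edgesWithin (insert w S : Finset V)).ncard := by
  have himg : ((fun a => s(w, a)) '' (N : Set V)).ncard = N.card := by
    rw [Set.ncard_image_of_injective _ fun a b hab => Sym2.congr_right.1 hab,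
      Set.ncard_coe_finset]
  rw [← himg, ← Set.ncard_union_eq]
  · refine Set.ncard_le_ncard ?_ (Set.toFinite _)
    rintro e (he | ⟨a, ha, rfl⟩)
    · exact ⟨he.1, fun a ha => Finset.mem_insert_of_mem (he.2 a ha)⟩
    · exact mk_mem_edgesWithin.2 ⟨(hN a ha).2, by simp, by simp [(hN a ha).1]⟩
  · rw [Set.disjoint_right]
    rintro _ ⟨a, -, rfl⟩ he
    exact hw (mk_mem_edgesWithin.1 he).2.1

lemma CyclomaticAtLeast.insert_one [Finite V] [DecidableEq V] {S : Finset V} {k : ℕ}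
    (h : G.CyclomaticAtLeast S k) {w a : V} (ha : a ∈ S) (hwa : G.Adj w a) :
    G.CyclomaticAtLeast (insert w S) k := by
  by_cases hw : w ∈ S
  · rwa [Finset.insert_eq_of_mem hw]
  have := ncard_edgesWithin_add_le (G := G) hw (N := {a}) (by simp [ha, hwa])
  rw [Finset.card_singleton] at this
  rw [CyclomaticAtLeast] at h ⊢
  rw [Finset.card_insert_of_notMem hw]
  omega

/-- One vertex and at least two edges are added, so the excess of edges grows by one. -/
lemma CyclomaticAtLeast.insert_two [Finite V] [DecidableEq V] {S : Finset V} {k : ℕ}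
    (h : G.CyclomaticAtLeast S k) {w a b : V} (hw : w ∉ S) (ha : a ∈ S) (hb : b ∈ S) (hab : a ≠ b)
    (hwa : G.Adj w a) (hwb : G.Adj w b) : G.CyclomaticAtLeast (insert w S) (k + 1) := by
  have := ncard_edgesWithin_add_le (G := G) hw (N := {a, b}) (by simp [ha, hwa, hb, hwb])
  rw [Finset.card_pair hab] at this
  rw [CyclomaticAtLeast] at h ⊢
  rw [Finset.card_insert_of_notMem hw]
  omega

/-- Each vertex outside `S` picks an edge into `S`. These edges are distinct and none lies within
`S`, so extending `S` to all vertices loses nothing of the excess, which is 1 for the whole graph.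
-/
lemma CyclomaticAtLeast.le_two [Finite V] (hG : G.edgeSet.ncard = Nat.card V + 1) {S : Finset V}
    {k : ℕ} (h : G.CyclomaticAtLeast S k) (hdom : ∀ w ∉ S, ∃ a ∈ S, G.Adj w a) : k ≤ 2 := by
  classical
  have := Fintype.ofFinite V
  choose! f hfS hf using hdom
  have hinj : Set.InjOn (fun w => s(w, f w)) (Sᶜ : Finset V) := by
    intro a ha b hb hab
    simp only [Finset.coe_compl, Set.mem_compl_iff, Finset.mem_coe] at ha hb
    rcases Sym2.eq_iff.1 hab with h | h
    · exact h.1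
    · exact absurd (h.1 ▸ hfS b hb) ha
  have hle : (G.edgesWithin S ∪ (fun w => s(w, f w)) '' (Sᶜ : Finset V)).ncard ≤
      G.edgeSet.ncard := by
    refine Set.ncard_le_ncard ?_ (Set.toFinite _)
    rintro e (he | ⟨a, ha, rfl⟩)
    · exact he.1
    · exact hf a (by simpa using ha)
  rw [Set.ncard_union_eq, hinj.ncard_image, Set.ncard_coe_finset, Finset.card_compl,
    hG, Nat.card_eq_fintype_card] at hle
  · have := S.card_le_univ
    rw [CyclomaticAtLeast] at h
    omega
  · rw [Set.disjoint_right]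
    rintro _ ⟨a, ha, rfl⟩ he
    exact (by simpa using ha : a ∉ S) (mk_mem_edgesWithin.1 he).2.1

lemma exists_adj_notMem_of_card_lt [Finite V] {F : Finset (Sym2 V)} (hF : F.card < G.edgeSet.ncard) :
    ∃ a b, G.Adj a b ∧ s(a, b) ∉ F := by
  rw [← Set.ncard_coe_finset] at hF
  obtain ⟨e, he, hn⟩ := Set.exists_mem_notMem_of_ncard_lt_ncard hF
  induction e with
  | _ a b => exact ⟨a, b, he, by simpa using hn⟩

lemma Connected.exists_adj_notMem (hG : G.Connected) {S : Set V} {a b : V} (ha : a ∈ S)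
    (hb : b ∉ S) : ∃ c ∈ S, ∃ d ∉ S, G.Adj c d := by
  obtain ⟨p⟩ := hG.preconnected a b
  obtain ⟨d, -, h1, h2⟩ := p.exists_boundary_dart S ha hb
  exact ⟨_, h1, _, h2, d.adj⟩

end SimpleGraph

/-! ### Recognizing the listed graphs -/

instance graphOfEdges.decidableRel {n : ℕ} (E : List (Fin n × Fin n)) :
    DecidableRel (graphOfEdges n E).Adj :=
  inferInstanceAs (DecidableRel (SimpleGraph.fromRel fun a b => (a, b) ∈ E).Adj)

instance : DecidableRel graph12.Adj := graphOfEdges.decidableRel _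
instance : DecidableRel graph13.Adj := graphOfEdges.decidableRel _
instance : DecidableRel graph14.Adj := graphOfEdges.decidableRel _
instance : DecidableRel graph15.Adj := graphOfEdges.decidableRel _
instance : DecidableRel graph16.Adj := graphOfEdges.decidableRel _
instance : DecidableRel graph17.Adj := graphOfEdges.decidableRel _
instance : DecidableRel graph18.Adj := graphOfEdges.decidableRel _
instance : DecidableRel graph19.Adj := graphOfEdges.decidableRel _
instance : DecidableRel graph20.Adj := graphOfEdges.decidableRel _
instance : DecidableRel graph21.Adj := graphOfEdges.decidableRel _
instance : DecidableRel graph22.Adj := graphOfEdges.decidableRel _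

/-- A bijection onto the vertices of `G` that maps the listed edges to edges is an isomorphism as
soon as there are as many listed edges as edges of `G`. -/
lemma graphOfEdges.exists_iso {V : Type*} [Finite V] {G : SimpleGraph V}
    (hG : G.edgeSet.ncard = Nat.card V + 1) {n : ℕ}
    (H : SimpleGraph (Fin n)) {E : List (Fin n × Fin n)} (hH : H = graphOfEdges n E)
    (hE : (graphOfEdges n E).edgeFinset.card = n + 1) (f : Fin n → V)
    {l : List V} (hl : List.ofFn f = l) (hf : l.Nodup) (hsurj : ∀ a, a ∈ l)
    (hadj : ∀ p ∈ E, G.Adj (f p.1) (f p.2)) :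
    ∃ g : H ≃g G, ∀ i, g i = f i := by
  subst hl hH
  rw [List.nodup_ofFn] at hf
  have hbij : f.Bijective := ⟨hf, fun a => by simpa [List.mem_ofFn] using hsurj a⟩
  have hmap : ∀ {i j}, (graphOfEdges n E).Adj i j → G.Adj (f i) (f j) := by
    intro i j hij
    rcases (SimpleGraph.fromRel_adj _ _ _).1 hij with ⟨-, h | h⟩
    · exact hadj _ h
    · exact (hadj _ h).symm
  have hcard : Nat.card V = n := by
    rw [← Nat.card_eq_of_bijective f hbij, Nat.card_fin]
  have hinj : Function.Injective (Sym2.map f) := Sym2.map.injective hf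
  have heq : Sym2.map f '' (graphOfEdges n E).edgeSet = G.edgeSet := by
    refine Set.eq_of_subset_of_ncard_le ?_ ?_ (Set.toFinite _)
    · rintro _ ⟨e, he, rfl⟩
      induction e with
      | _ i j => exact hmap he
    · rw [Set.ncard_image_of_injective _ hinj, hG, hcard, ← hE, ← SimpleGraph.coe_edgeFinset,
        Set.ncard_coe_finset]
  refine ⟨⟨Equiv.ofBijective f hbij, fun {i j} => ⟨fun h => ?_, fun h => hmap h⟩⟩, fun i => rfl⟩
  have h' : Sym2.map f s(i, j) ∈ Sym2.map f '' (graphOfEdges n E).edgeSet := heq ▸ h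
  obtain ⟨e, he, hee⟩ := h'
  rwa [hinj hee] at he

/-! ### The graph that remains after removing the pendant vertex and its neighbour -/

namespace QuatGainGraph

variable {V : Type*}

/-- One of the eleven graphs, with its gain condition. -/
def IsListed (Φ : QuatGainGraph V) : Prop :=
  (∃ f : graph12 ≃g Φ.graph, Φ.IsType4 [f 0, f 1, f 2]) ∨
    Nonempty (graph13 ≃g Φ.graph) ∨
    Nonempty (graph14 ≃g Φ.graph) ∨
    (∃ f : graph15 ≃g Φ.graph, Φ.IsType4 [f 0, f 1, f 3] ∧ Φ.IsType1 [f 0, f 1, f 2, f 3]) ∨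
    (∃ f : graph16 ≃g Φ.graph, Φ.IsType4 [f 0, f 1, f 3] ∧ Φ.IsType1 [f 0, f 1, f 2, f 3]) ∨
    (∃ f : graph17 ≃g Φ.graph, Φ.IsType1 [f 0, f 1, f 2, f 3]) ∨
    (∃ f : graph18 ≃g Φ.graph, Φ.IsType1 [f 0, f 1, f 2, f 3]) ∨
    Nonempty (graph19 ≃g Φ.graph) ∨
    Nonempty (graph20 ≃g Φ.graph) ∨
    (∃ f : graph21 ≃g Φ.graph,
      Φ.IsType1 [f 0, f 1, f 4, f 3] ∧ Φ.IsType1 [f 0, f 1, f 2, f 3]) ∨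
    (∃ f : graph22 ≃g Φ.graph,
      Φ.IsType1 [f 0, f 1, f 4, f 3] ∧ Φ.IsType1 [f 0, f 1, f 2, f 3])

/-- What is used of a connected bicyclic gain graph of rank 4 without pendant twins, in which `v`
is a pendant vertex with neighbour `u`. -/
structure IsReduction (Φ : QuatGainGraph V) (u v : V) : Prop where
  card_edges : Φ.graph.edgeSet.ncard = Nat.card V + 1
  pendant : Φ.PendantAt u v
  spanned : ∀ {x y}, x ∈ ({u, v}ᶜ : Set V) → y ∈ ({u, v}ᶜ : Set V) → Φ.graph.Adj x y →
    Φ.SpannedBy {u, v}ᶜ x y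
  adj_or_adj : ∀ {x y z}, x ∈ ({u, v}ᶜ : Set V) → y ∈ ({u, v}ᶜ : Set V) →
    z ∈ ({u, v}ᶜ : Set V) → Φ.graph.Adj x y → Φ.graph.Adj z x ∨ Φ.graph.Adj z y
  leaf_unique : ∀ {a x y}, Φ.PendantAt a x → Φ.PendantAt a y → x = y
  exists_adj : ∃ t ∈ ({u, v}ᶜ : Set V), Φ.graph.Adj u t

namespace IsReduction

variable [Finite V] {Φ : QuatGainGraph V} {u v : V} (R : Φ.IsReduction u v)
include R

/-- Adding to `S` a neighbour `t` of `u`, then `u`, then `v`, each along an edge, keeps the bound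
`k`. The enlarged set dominates, because every vertex other than `u` and `v` is adjacent to `x` or
`y`. -/
lemma cyclomatic_le_two {S : Finset V} {k : ℕ} (h : Φ.graph.CyclomaticAtLeast S k) {x y : V}
    (hx : x ∈ ({u, v}ᶜ : Set V)) (hy : y ∈ ({u, v}ᶜ : Set V)) (hxS : x ∈ S) (hyS : y ∈ S)
    (hxy : Φ.graph.Adj x y) : k ≤ 2 := by
  classical
  obtain ⟨t, ht, hut⟩ := R.exists_adj
  have h1 : Φ.graph.CyclomaticAtLeast (insert t S) k := by
    rcases R.adj_or_adj hx hy ht hxy with h' | h'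
    · exact h.insert_one hxS h'
    · exact h.insert_one hyS h'
  have h2 := h1.insert_one (w := u) (Finset.mem_insert_self t S) hut
  have h3 := h2.insert_one (w := v) (Finset.mem_insert_self u _) R.pendant.adj
  refine h3.le_two R.card_edges fun w hw => ?_
  simp only [Finset.mem_insert, not_or] at hw
  rcases R.adj_or_adj hx hy (z := w) (by simp [hw.1, hw.2.1]) hxy with h' | h'
  · exact ⟨x, by simp [hxS], h'⟩
  · exact ⟨y, by simp [hyS], h'⟩

/-- The edges in `F`, the edge `uv` and the edges from `u` to `N` number at most `Nat.card V`, one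
less than all edges. An edge outside this collection must join `u` to a new vertex of `{u, v}ᶜ`. -/
lemma exists_adj_notMem {F : Finset (Sym2 V)}
    (hF : ∀ x ∈ ({u, v}ᶜ : Set V), ∀ y ∈ ({u, v}ᶜ : Set V), Φ.graph.Adj x y → s(x, y) ∈ F)
    (N : Finset V) (hN : F.card + N.card < Nat.card V) :
    ∃ t ∈ ({u, v}ᶜ : Set V), Φ.graph.Adj u t ∧ t ∉ N := by
  classical
  have hcard : (insert s(u, v) (F ∪ N.image fun a => s(u, a))).card <
      Φ.graph.edgeSet.ncard := by
    have h1 := Finset.card_insert_le s(u, v) (F ∪ N.image fun a => s(u, a))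
    have h2 := Finset.card_union_le F (N.image fun a => s(u, a))
    have h3 : (N.image fun a => s(u, a)).card ≤ N.card := Finset.card_image_le
    rw [R.card_edges]
    omega
  obtain ⟨a, b, hab, hn⟩ := SimpleGraph.exists_adj_notMem_of_card_lt hcard
  simp only [Finset.mem_insert, Finset.mem_union, Finset.mem_image, not_or, not_exists,
    not_and] at hn
  obtain ⟨hn1, hn2, hn3⟩ := hn
  have hav : a ≠ v := by
    rintro rfl
    exact hn1 (by rw [R.pendant.adj_iff.1 hab, Sym2.eq_swap])
  have hbv : b ≠ v := by
    rintro rfl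
    exact hn1 (by rw [R.pendant.adj_iff.1 hab.symm])
  by_cases hau : a = u
  · subst hau
    exact ⟨b, by simp [hbv, hab.ne'], hab, fun h => hn3 b h rfl⟩
  by_cases hbu : b = u
  · subst hbu
    exact ⟨a, by simp [hav, hab.ne], hab.symm, fun h => hn3 a h Sym2.eq_swap⟩
  exact absurd (hF a (by simp [hau, hav]) b (by simp [hbu, hbv]) hab) hn2

omit [Finite V] in
lemma isType4 {x y z : V} (hx : x ∈ ({u, v}ᶜ : Set V)) (hy : y ∈ ({u, v}ᶜ : Set V))
    (hz : z ∈ ({u, v}ᶜ : Set V)) (hxy : Φ.graph.Adj x y)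
    (hyz : Φ.graph.Adj y z) (hzx : Φ.graph.Adj z x) : Φ.IsType4 [x, y, z] :=
  (R.spanned hx hy hxy).isType4 hz hxy hyz hzx

omit [Finite V] in
lemma isType1 {x y z w : V} (hx : x ∈ ({u, v}ᶜ : Set V)) (hy : y ∈ ({u, v}ᶜ : Set V))
    (hz : z ∈ ({u, v}ᶜ : Set V)) (hw : w ∈ ({u, v}ᶜ : Set V)) (hxz : x ≠ z) (hyw : y ≠ w)
    (hxy : Φ.graph.Adj x y) (hyz : Φ.graph.Adj y z) (hzw : Φ.graph.Adj z w)
    (hwx : Φ.graph.Adj w x) (hn : ¬ Φ.graph.Adj z x) : Φ.IsType1 [x, y, z, w] :=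
  (R.spanned hx hy hxy).isType1 hz hw hxz hyw hxy hyz hzw hwx hn

omit [Finite V] in
/-- If `z` and `x` are nonadjacent and have a common neighbour, then every neighbour of `x` is a
neighbour of `z`. -/
lemma adj_of_path {x y z w : V} (hx : x ∈ ({u, v}ᶜ : Set V)) (hy : y ∈ ({u, v}ᶜ : Set V))
    (hz : z ∈ ({u, v}ᶜ : Set V)) (hw : w ∈ ({u, v}ᶜ : Set V)) (hzy : Φ.graph.Adj z y)
    (hyx : Φ.graph.Adj y x) (hxw : Φ.graph.Adj x w) (hn : ¬ Φ.graph.Adj z x) : Φ.graph.Adj z w :=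
  ((R.spanned hx hy hyx.symm).adj_iff_of_not_adj_left hz hw hyx.symm hn hzy).2 hxw

omit [Finite V] in
lemma nodup_append {l : List V} (hl : l.Nodup) (hmem : ∀ a ∈ l, a ∈ ({u, v}ᶜ : Set V)) :
    (l ++ [u, v]).Nodup := by
  rw [List.nodup_append]
  refine ⟨hl, by simp [R.pendant.ne], fun a ha b hb => ?_⟩
  rintro rfl
  have := hmem a ha
  simp_all

omit R [Finite V] in
lemma mem_append {l : List V} (hl : ∀ a ∈ ({u, v}ᶜ : Set V), a ∈ l) (a : V) :
    a ∈ l ++ [u, v] := by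
  by_cases ha : a ∈ ({u, v}ᶜ : Set V)
  · simp [hl a ha]
  · simp only [Set.mem_compl_iff, not_not] at ha
    simp_all

omit R in
lemma card_eq {l : List V} (hl : (l ++ [u, v]).Nodup) (h : ∀ a, a ∈ l ++ [u, v]) :
    Nat.card V = l.length + 2 := by
  classical
  have := Fintype.ofFinite V
  rw [Nat.card_eq_fintype_card, ← Finset.card_univ, ← (Finset.eq_univ_iff_forall.2 fun a =>
    List.mem_toFinset.2 (h a)), List.toFinset_card_of_nodup hl]
  simp

end IsReduction
end QuatGainGraph

/-! ### The remaining graph contains a triangle -/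

namespace QuatGainGraph.IsReduction

open SimpleGraph (cyclomaticAtLeast_singleton)

variable {V : Type*} [Finite V] {Φ : QuatGainGraph V} {u v : V} (R : Φ.IsReduction u v)
include R

lemma isListed_of_diamond_of_adj_hub {p q r w : V} (hp : p ∈ ({u, v}ᶜ : Set V))
    (hq : q ∈ ({u, v}ᶜ : Set V)) (hr : r ∈ ({u, v}ᶜ : Set V)) (hw : w ∈ ({u, v}ᶜ : Set V))
    (hpq : Φ.graph.Adj p q) (hqr : Φ.graph.Adj q r) (hrp : Φ.graph.Adj r p)
    (hwp : Φ.graph.Adj w p) (hwq : Φ.graph.Adj w q) (hwr : w ≠ r)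
    (hall : ∀ z ∈ ({u, v}ᶜ : Set V), z ∈ [r, p, w, q]) (hut : Φ.graph.Adj u p) :
    Φ.IsListed := by
  obtain ⟨g, hg⟩ := graphOfEdges.exists_iso R.card_edges graph16 rfl (by decide)
    ![r, p, w, q, u, v] (l := [r, p, w, q] ++ [u, v]) rfl
    (R.nodup_append (by simp [hpq.ne, hqr.ne', hrp.ne, hwp.ne', hwq.ne, hwr.symm])
      (by simp only [List.forall_mem_cons]; exact ⟨hr, hp, hw, hq, by simp⟩)) (mem_append hall)
    (by simpa using ⟨hrp, hwp.symm, hwq, hqr, hpq, hut.symm, R.pendant.adj.symm⟩)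
  -- That `w` and `r` are not adjacent is not assumed: the edge count behind the isomorphism leaves
  -- no room for that edge.
  have hn : ¬ Φ.graph.Adj (g 2) (g 0) := g.map_adj_iff.not.2 (by decide)
  simp only [hg] at hn
  refine .inr <| .inr <| .inr <| .inr <| .inl ⟨g, ?_⟩
  simp only [hg]
  exact ⟨R.isType4 hr hp hq hrp hpq hqr,
    R.isType1 hr hp hw hq hwr.symm hpq.ne hrp hwp.symm hwq hqr hn⟩

lemma isListed_of_diamond_of_adj_tip {p q r w : V} (hp : p ∈ ({u, v}ᶜ : Set V))
    (hq : q ∈ ({u, v}ᶜ : Set V)) (hr : r ∈ ({u, v}ᶜ : Set V)) (hw : w ∈ ({u, v}ᶜ : Set V))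
    (hpq : Φ.graph.Adj p q) (hqr : Φ.graph.Adj q r) (hrp : Φ.graph.Adj r p)
    (hwp : Φ.graph.Adj w p) (hwq : Φ.graph.Adj w q) (hwr : w ≠ r)
    (hall : ∀ z ∈ ({u, v}ᶜ : Set V), z ∈ [r, p, w, q]) (hut : Φ.graph.Adj u r) :
    Φ.IsListed := by
  obtain ⟨g, hg⟩ := graphOfEdges.exists_iso R.card_edges graph15 rfl (by decide)
    ![r, p, w, q, u, v] (l := [r, p, w, q] ++ [u, v]) rfl
    (R.nodup_append (by simp [hpq.ne, hqr.ne', hrp.ne, hwp.ne', hwq.ne, hwr.symm])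
      (by simp only [List.forall_mem_cons]; exact ⟨hr, hp, hw, hq, by simp⟩)) (mem_append hall)
    (by simpa using ⟨hrp, hwp.symm, hwq, hqr, hpq, hut.symm, R.pendant.adj.symm⟩)
  have hn : ¬ Φ.graph.Adj (g 2) (g 0) := g.map_adj_iff.not.2 (by decide)
  simp only [hg] at hn
  refine .inr <| .inr <| .inr <| .inl ⟨g, ?_⟩
  simp only [hg]
  exact ⟨R.isType4 hr hp hq hrp hpq hqr,
    R.isType1 hr hp hw hq hwr.symm hpq.ne hrp hwp.symm hwq hqr hn⟩

omit [Finite V] in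
/-- In the presence of a triangle, every other vertex is adjacent to two of its vertices. -/
lemma adj_two_of_triangle {p q r z : V} (hp : p ∈ ({u, v}ᶜ : Set V))
    (hq : q ∈ ({u, v}ᶜ : Set V)) (hr : r ∈ ({u, v}ᶜ : Set V)) (hz : z ∈ ({u, v}ᶜ : Set V))
    (hpq : Φ.graph.Adj p q) (hqr : Φ.graph.Adj q r) (hrp : Φ.graph.Adj r p) :
    Φ.graph.Adj z p ∧ Φ.graph.Adj z q ∨ Φ.graph.Adj z q ∧ Φ.graph.Adj z r ∨
      Φ.graph.Adj z r ∧ Φ.graph.Adj z p := by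
  have h1 := R.adj_or_adj hp hq hz hpq
  have h2 := R.adj_or_adj hq hr hz hqr
  have h3 := R.adj_or_adj hr hp hz hrp
  tauto

/-- The diamond with chord `pq` already has cyclomatic number 2. A further vertex would be adjacent
to two vertices of the triangle `pqr` and raise it to 3, so the diamond is everything. By symmetry
`u` is attached at an end of the chord or at a tip. -/
lemma isListed_of_diamond {p q r w : V} (hp : p ∈ ({u, v}ᶜ : Set V))
    (hq : q ∈ ({u, v}ᶜ : Set V)) (hr : r ∈ ({u, v}ᶜ : Set V)) (hw : w ∈ ({u, v}ᶜ : Set V))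
    (hpq : Φ.graph.Adj p q) (hqr : Φ.graph.Adj q r) (hrp : Φ.graph.Adj r p)
    (hwp : Φ.graph.Adj w p) (hwq : Φ.graph.Adj w q) (hwr : w ≠ r) : Φ.IsListed := by
  classical
  have hall : ∀ z ∈ ({u, v}ᶜ : Set V), z ∈ [r, p, w, q] := by
    intro z hz
    by_contra hn
    simp only [List.mem_cons, List.not_mem_nil, or_false, not_or] at hn
    have hS : Φ.graph.CyclomaticAtLeast {w, r, q, p} 2 :=
      (((cyclomaticAtLeast_singleton p).insert_one (w := q) (by simp) hpq.symm).insert_two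
        (by simp [hqr.ne', hrp.ne]) (by simp) (by simp) hpq.ne' hqr.symm hrp).insert_two
        (by simp [hwr, hwq.ne, hwp.ne]) (by simp) (by simp) hpq.ne' hwq hwp
    have hzS : z ∉ ({w, r, q, p} : Finset V) := by simp [hn]
    have hS' : Φ.graph.CyclomaticAtLeast {z, w, r, q, p} 3 := by
      rcases R.adj_two_of_triangle hp hq hr hz hpq hqr hrp with h | h | h
      · exact hS.insert_two hzS (by simp) (by simp) hpq.ne h.1 h.2
      · exact hS.insert_two hzS (by simp) (by simp) hqr.ne h.1 h.2
      · exact hS.insert_two hzS (by simp) (by simp) hrp.ne h.1 h.2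
    have := R.cyclomatic_le_two hS' hp hq (by simp) (by simp) hpq
    omega
  obtain ⟨t, ht, hut⟩ := R.exists_adj
  have ht' := hall t ht
  simp only [List.mem_cons, List.not_mem_nil, or_false] at ht'
  rcases ht' with rfl | rfl | rfl | rfl
  · exact R.isListed_of_diamond_of_adj_tip hp hq hr hw hpq hqr hrp hwp hwq hwr hall hut
  · exact R.isListed_of_diamond_of_adj_hub hp hq hr hw hpq hqr hrp hwp hwq hwr hall hut
  · refine R.isListed_of_diamond_of_adj_tip hp hq hw hr hpq hwq.symm hwp hrp hqr.symm hwr.symm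
      (fun z hz => ?_) hut
    have := hall z hz
    simp only [List.mem_cons] at this ⊢
    tauto
  · refine R.isListed_of_diamond_of_adj_hub hq hp hr hw hpq.symm hrp.symm hqr.symm hwq hwp hwr
      (fun z hz => ?_) hut
    have := hall z hz
    simp only [List.mem_cons] at this ⊢
    tauto

lemma isListed_of_triangle_of_adj_two {p q r : V} (hp : p ∈ ({u, v}ᶜ : Set V))
    (hq : q ∈ ({u, v}ᶜ : Set V)) (hr : r ∈ ({u, v}ᶜ : Set V))
    (hpq : Φ.graph.Adj p q) (hqr : Φ.graph.Adj q r) (hrp : Φ.graph.Adj r p)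
    (hall : ∀ z ∈ ({u, v}ᶜ : Set V), z ∈ [p, q, r]) (huq : Φ.graph.Adj u q)
    (hur : Φ.graph.Adj u r) : Φ.IsListed := by
  obtain ⟨g, hg⟩ := graphOfEdges.exists_iso R.card_edges graph12 rfl (by decide)
    ![p, q, r, u, v] (l := [p, q, r] ++ [u, v]) rfl
    (R.nodup_append (by simp [hpq.ne, hqr.ne, hrp.ne'])
      (by simp only [List.forall_mem_cons]; exact ⟨hp, hq, hr, by simp⟩)) (mem_append hall)
    (by simpa using ⟨hpq, hrp.symm, hqr, huq.symm, hur.symm, R.pendant.adj.symm⟩)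
  refine .inl ⟨g, ?_⟩
  simp only [hg]
  exact R.isType4 hp hq hr hpq hqr hrp

/-- A vertex outside the triangle creates a diamond. Otherwise there are 5 vertices and 6 edges;
three edges lie in the triangle and one is `uv`, so `u` has two neighbours in the triangle. -/
lemma isListed_of_triangle {p q r : V} (hp : p ∈ ({u, v}ᶜ : Set V))
    (hq : q ∈ ({u, v}ᶜ : Set V)) (hr : r ∈ ({u, v}ᶜ : Set V))
    (hpq : Φ.graph.Adj p q) (hqr : Φ.graph.Adj q r) (hrp : Φ.graph.Adj r p) : Φ.IsListed := by
  classical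
  by_cases hall : ∀ z ∈ ({u, v}ᶜ : Set V), z ∈ [p, q, r]
  · have hcard : Nat.card V = 5 := card_eq
      (R.nodup_append (l := [p, q, r]) (by simp [hpq.ne, hqr.ne, hrp.ne'])
        (by simp only [List.forall_mem_cons]; exact ⟨hp, hq, hr, by simp⟩)) (mem_append hall)
    obtain ⟨t, ht, hut⟩ := R.exists_adj
    have hF : ∀ x ∈ ({u, v}ᶜ : Set V), ∀ y ∈ ({u, v}ᶜ : Set V), Φ.graph.Adj x y →
        s(x, y) ∈ ({s(p, q), s(q, r), s(r, p)} : Finset (Sym2 V)) := by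
      intro x hx y hy hxy
      have hx' := hall x hx
      have hy' := hall y hy
      simp only [List.mem_cons, List.not_mem_nil, or_false] at hx' hy'
      rcases hx' with rfl | rfl | rfl <;> rcases hy' with rfl | rfl | rfl <;>
        first
        | exact absurd rfl hxy.ne
        | simp
    obtain ⟨t', ht', hut', hne⟩ := R.exists_adj_notMem hF {t} (by
      have h3 : ({s(p, q), s(q, r), s(r, p)} : Finset (Sym2 V)).card ≤ 3 := Finset.card_le_three
      rw [Finset.card_singleton, hcard]
      omega)
    rw [Finset.mem_singleton] at hne
    have hall' : ∀ z ∈ ({u, v}ᶜ : Set V), z ∈ [q, r, p] := fun z hz => by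
      have := hall z hz
      simp only [List.mem_cons] at this ⊢
      tauto
    have hall'' : ∀ z ∈ ({u, v}ᶜ : Set V), z ∈ [r, p, q] := fun z hz => by
      have := hall z hz
      simp only [List.mem_cons] at this ⊢
      tauto
    have htl := hall t ht
    have htl' := hall t' ht'
    simp only [List.mem_cons, List.not_mem_nil, or_false] at htl htl'
    rcases htl with rfl | rfl | rfl <;> rcases htl' with rfl | rfl | rfl
    · exact absurd rfl hne
    · exact R.isListed_of_triangle_of_adj_two hr ht ht' hrp hpq hqr hall'' hut hut'
    · exact R.isListed_of_triangle_of_adj_two hq ht' ht hqr hrp hpq hall' hut' hut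
    · exact R.isListed_of_triangle_of_adj_two hr ht' ht hrp hpq hqr hall'' hut' hut
    · exact absurd rfl hne
    · exact R.isListed_of_triangle_of_adj_two hp ht ht' hpq hqr hrp hall hut hut'
    · exact R.isListed_of_triangle_of_adj_two hq ht ht' hqr hrp hpq hall' hut hut'
    · exact R.isListed_of_triangle_of_adj_two hp ht' ht hpq hqr hrp hall hut' hut
    · exact absurd rfl hne
  · push Not at hall
    obtain ⟨z, hz, hn⟩ := hall
    simp only [List.mem_cons, List.not_mem_nil, or_false, not_or] at hn
    rcases R.adj_two_of_triangle hp hq hr hz hpq hqr hrp with h | h | h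
    · exact R.isListed_of_diamond hp hq hr hz hpq hqr hrp h.1 h.2 hn.2.2
    · exact R.isListed_of_diamond hq hr hp hz hqr hrp hpq h.1 h.2 hn.1
    · exact R.isListed_of_diamond hr hp hq hz hrp hpq hqr h.1 h.2 hn.2.1

end QuatGainGraph.IsReduction

/-! ### The remaining graph is a quadrangle or `K_{2,3}` -/

namespace QuatGainGraph.IsReduction

open SimpleGraph (cyclomaticAtLeast_singleton)

variable {V : Type*} [Finite V] {Φ : QuatGainGraph V} {u v : V} (R : Φ.IsReduction u v)
include R

lemma isListed_of_quadrangle_of_adj_consecutive {p q r s : V} (hp : p ∈ ({u, v}ᶜ : Set V))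
    (hq : q ∈ ({u, v}ᶜ : Set V)) (hr : r ∈ ({u, v}ᶜ : Set V)) (hs : s ∈ ({u, v}ᶜ : Set V))
    (hpq : Φ.graph.Adj p q) (hqr : Φ.graph.Adj q r) (hrs : Φ.graph.Adj r s)
    (hsp : Φ.graph.Adj s p) (hpr : p ≠ r) (hqs : q ≠ s)
    (hall : ∀ z ∈ ({u, v}ᶜ : Set V), z ∈ [p, q, r, s]) (hup : Φ.graph.Adj u p)
    (huq : Φ.graph.Adj u q) : Φ.IsListed := by
  obtain ⟨g, hg⟩ := graphOfEdges.exists_iso R.card_edges graph17 rfl (by decide)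
    ![p, q, r, s, u, v] (l := [p, q, r, s] ++ [u, v]) rfl
    (R.nodup_append (by simp [hpq.ne, hqr.ne, hrs.ne, hsp.ne', hpr, hqs])
      (by simp only [List.forall_mem_cons]; exact ⟨hp, hq, hr, hs, by simp⟩)) (mem_append hall)
    (by simpa using ⟨hpq, hqr, hrs, hsp, hup.symm, huq.symm, R.pendant.adj.symm⟩)
  have hn : ¬ Φ.graph.Adj (g 2) (g 0) := g.map_adj_iff.not.2 (by decide)
  simp only [hg] at hn
  refine .inr <| .inr <| .inr <| .inr <| .inr <| .inl ⟨g, ?_⟩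
  simp only [hg]
  exact R.isType1 hp hq hr hs hpr hqs hpq hqr hrs hsp hn

lemma isListed_of_quadrangle_of_adj_opposite {p q r s : V} (hp : p ∈ ({u, v}ᶜ : Set V))
    (hq : q ∈ ({u, v}ᶜ : Set V)) (hr : r ∈ ({u, v}ᶜ : Set V)) (hs : s ∈ ({u, v}ᶜ : Set V))
    (hpq : Φ.graph.Adj p q) (hqr : Φ.graph.Adj q r) (hrs : Φ.graph.Adj r s)
    (hsp : Φ.graph.Adj s p) (hpr : p ≠ r) (hqs : q ≠ s)
    (hall : ∀ z ∈ ({u, v}ᶜ : Set V), z ∈ [p, q, r, s]) (huq : Φ.graph.Adj u q)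
    (hus : Φ.graph.Adj u s) : Φ.IsListed := by
  obtain ⟨g, hg⟩ := graphOfEdges.exists_iso R.card_edges graph18 rfl (by decide)
    ![p, q, r, s, u, v] (l := [p, q, r, s] ++ [u, v]) rfl
    (R.nodup_append (by simp [hpq.ne, hqr.ne, hrs.ne, hsp.ne', hpr, hqs])
      (by simp only [List.forall_mem_cons]; exact ⟨hp, hq, hr, hs, by simp⟩)) (mem_append hall)
    (by simpa using ⟨hpq, hqr, hrs, hsp, huq.symm, hus.symm, R.pendant.adj.symm⟩)
  have hn : ¬ Φ.graph.Adj (g 2) (g 0) := g.map_adj_iff.not.2 (by decide)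
  simp only [hg] at hn
  refine .inr <| .inr <| .inr <| .inr <| .inr <| .inr <| .inl ⟨g, ?_⟩
  simp only [hg]
  exact R.isType1 hp hq hr hs hpr hqs hpq hqr hrs hsp hn

/-- The vertices other than `u` and `v` form a quadrangle. -/
lemma isListed_of_quadrangle {p q r s : V} (hp : p ∈ ({u, v}ᶜ : Set V))
    (hq : q ∈ ({u, v}ᶜ : Set V)) (hr : r ∈ ({u, v}ᶜ : Set V)) (hs : s ∈ ({u, v}ᶜ : Set V))
    (hpq : Φ.graph.Adj p q) (hqr : Φ.graph.Adj q r) (hrs : Φ.graph.Adj r s)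
    (hsp : Φ.graph.Adj s p) (hpr : p ≠ r) (hqs : q ≠ s) (hnpr : ¬ Φ.graph.Adj p r)
    (hnqs : ¬ Φ.graph.Adj q s) (hall : ∀ z ∈ ({u, v}ᶜ : Set V), z ∈ [p, q, r, s]) :
    Φ.IsListed := by
  classical
  have hcard : Nat.card V = 6 := card_eq
    (R.nodup_append (l := [p, q, r, s]) (by simp [hpq.ne, hqr.ne, hrs.ne, hsp.ne', hpr, hqs])
      (by simp only [List.forall_mem_cons]; exact ⟨hp, hq, hr, hs, by simp⟩)) (mem_append hall)
  obtain ⟨t, ht, hut⟩ := R.exists_adj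
  have hF : ∀ x ∈ ({u, v}ᶜ : Set V), ∀ y ∈ ({u, v}ᶜ : Set V), Φ.graph.Adj x y →
      s(x, y) ∈ ({s(p, q), s(q, r), s(r, s), s(s, p)} : Finset (Sym2 V)) := by
    intro x hx y hy hxy
    have hx' := hall x hx
    have hy' := hall y hy
    simp only [List.mem_cons, List.not_mem_nil, or_false] at hx' hy'
    rcases hx' with rfl | rfl | rfl | rfl <;> rcases hy' with rfl | rfl | rfl | rfl <;>
      first
      | exact absurd rfl hxy.ne
      | exact absurd hxy hnpr
      | exact absurd hxy.symm hnpr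
      | exact absurd hxy hnqs
      | exact absurd hxy.symm hnqs
      | simp
  -- Of the 7 edges, four form the quadrangle and one is `uv`, so `u` has a second neighbour in it.
  obtain ⟨t', ht', hut', hne⟩ := R.exists_adj_notMem hF {t} (by
    have h4 : ({s(p, q), s(q, r), s(r, s), s(s, p)} : Finset (Sym2 V)).card ≤ 4 :=
      Finset.card_le_four
    rw [Finset.card_singleton, hcard]
    omega)
  rw [Finset.mem_singleton] at hne
  -- The quadrangle may be rotated until `t` comes first; then only the position of `t'` relative to
  -- `t` matters.
  have key : ∀ {p q r s : V}, p ∈ ({u, v}ᶜ : Set V) → q ∈ ({u, v}ᶜ : Set V) →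
      r ∈ ({u, v}ᶜ : Set V) → s ∈ ({u, v}ᶜ : Set V) → Φ.graph.Adj p q → Φ.graph.Adj q r →
      Φ.graph.Adj r s → Φ.graph.Adj s p → p ≠ r → q ≠ s →
      (∀ z ∈ ({u, v}ᶜ : Set V), z ∈ [p, q, r, s]) → t = p → Φ.IsListed := by
    intro p q r s hp hq hr hs hpq hqr hrs hsp hpr hqs hall htp
    subst htp
    have htl' := hall t' ht'
    simp only [List.mem_cons, List.not_mem_nil, or_false] at htl'
    rcases htl' with rfl | rfl | rfl | rfl
    · exact absurd rfl hne
    · exact R.isListed_of_quadrangle_of_adj_consecutive hp hq hr hs hpq hqr hrs hsp hpr hqs hall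
        hut hut'
    · exact R.isListed_of_quadrangle_of_adj_opposite hs hp hq hr hsp hpq hqr hrs hqs.symm hpr
        (fun z hz => by have := hall z hz; simp only [List.mem_cons] at this ⊢; tauto) hut hut'
    · exact R.isListed_of_quadrangle_of_adj_consecutive hs hp hq hr hsp hpq hqr hrs hqs.symm hpr
        (fun z hz => by have := hall z hz; simp only [List.mem_cons] at this ⊢; tauto) hut' hut
  have htl := hall t ht
  simp only [List.mem_cons, List.not_mem_nil, or_false] at htl
  rcases htl with h | h | h | h
  · exact key hp hq hr hs hpq hqr hrs hsp hpr hqs hall h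
  · exact key hq hr hs hp hqr hrs hsp hpq hqs hpr.symm
      (fun z hz => by have := hall z hz; simp only [List.mem_cons] at this ⊢; tauto) h
  · exact key hr hs hp hq hrs hsp hpq hqr hpr.symm hqs.symm
      (fun z hz => by have := hall z hz; simp only [List.mem_cons] at this ⊢; tauto) h
  · exact key hs hp hq hr hsp hpq hqr hrs hqs.symm hpr
      (fun z hz => by have := hall z hz; simp only [List.mem_cons] at this ⊢; tauto) h

lemma isListed_of_completeBipartite_of_adj_side_three {a b c d e : V}
    (ha : a ∈ ({u, v}ᶜ : Set V)) (hb : b ∈ ({u, v}ᶜ : Set V)) (hc : c ∈ ({u, v}ᶜ : Set V))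
    (hd : d ∈ ({u, v}ᶜ : Set V)) (he : e ∈ ({u, v}ᶜ : Set V)) (hac : Φ.graph.Adj a c)
    (hbc : Φ.graph.Adj b c) (had : Φ.graph.Adj a d) (hbd : Φ.graph.Adj b d)
    (hae : Φ.graph.Adj a e) (hbe : Φ.graph.Adj b e) (hab : a ≠ b) (hcd : c ≠ d) (hce : c ≠ e)
    (hde : d ≠ e) (hall : ∀ z ∈ ({u, v}ᶜ : Set V), z ∈ [c, a, d, b, e])
    (hut : Φ.graph.Adj u c) : Φ.IsListed := by
  obtain ⟨g, hg⟩ := graphOfEdges.exists_iso R.card_edges graph21 rfl (by decide)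
    ![c, a, d, b, e, u, v] (l := [c, a, d, b, e] ++ [u, v]) rfl
    (R.nodup_append (by
      simp [hac.ne', hbc.ne', had.ne, hbd.ne', hae.ne, hbe.ne, hab, hcd, hce, hde])
      (by simp only [List.forall_mem_cons]; exact ⟨hc, ha, hd, hb, he, by simp⟩))
    (mem_append hall)
    (by simpa using ⟨hac.symm, had, hbd.symm, hbc, hae, hbe, hut.symm, R.pendant.adj.symm⟩)
  have hn2 : ¬ Φ.graph.Adj (g 2) (g 0) := g.map_adj_iff.not.2 (by decide)
  have hn4 : ¬ Φ.graph.Adj (g 4) (g 0) := g.map_adj_iff.not.2 (by decide)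
  simp only [hg] at hn2 hn4
  refine .inr <| .inr <| .inr <| .inr <| .inr <| .inr <| .inr <| .inr <| .inr <| .inl ⟨g, ?_⟩
  simp only [hg]
  exact ⟨R.isType1 hc ha he hb hce hab hac.symm hae hbe.symm hbc hn4,
    R.isType1 hc ha hd hb hcd hab hac.symm had hbd.symm hbc hn2⟩

lemma isListed_of_completeBipartite_of_adj_side_two {a b c d e : V}
    (ha : a ∈ ({u, v}ᶜ : Set V)) (hb : b ∈ ({u, v}ᶜ : Set V)) (hc : c ∈ ({u, v}ᶜ : Set V))
    (hd : d ∈ ({u, v}ᶜ : Set V)) (he : e ∈ ({u, v}ᶜ : Set V)) (hac : Φ.graph.Adj a c)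
    (hbc : Φ.graph.Adj b c) (had : Φ.graph.Adj a d) (hbd : Φ.graph.Adj b d)
    (hae : Φ.graph.Adj a e) (hbe : Φ.graph.Adj b e) (hab : a ≠ b) (hcd : c ≠ d) (hce : c ≠ e)
    (hde : d ≠ e) (hall : ∀ z ∈ ({u, v}ᶜ : Set V), z ∈ [c, a, d, b, e])
    (hut : Φ.graph.Adj u a) : Φ.IsListed := by
  obtain ⟨g, hg⟩ := graphOfEdges.exists_iso R.card_edges graph22 rfl (by decide)
    ![c, a, d, b, e, u, v] (l := [c, a, d, b, e] ++ [u, v]) rfl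
    (R.nodup_append (by
      simp [hac.ne', hbc.ne', had.ne, hbd.ne', hae.ne, hbe.ne, hab, hcd, hce, hde])
      (by simp only [List.forall_mem_cons]; exact ⟨hc, ha, hd, hb, he, by simp⟩))
    (mem_append hall)
    (by simpa using ⟨hac.symm, had, hbd.symm, hbc, hae, hbe, hut.symm, R.pendant.adj.symm⟩)
  have hn2 : ¬ Φ.graph.Adj (g 2) (g 0) := g.map_adj_iff.not.2 (by decide)
  have hn4 : ¬ Φ.graph.Adj (g 4) (g 0) := g.map_adj_iff.not.2 (by decide)
  simp only [hg] at hn2 hn4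
  refine .inr <| .inr <| .inr <| .inr <| .inr <| .inr <| .inr <| .inr <| .inr <| .inr ⟨g, ?_⟩
  simp only [hg]
  exact ⟨R.isType1 hc ha he hb hce hab hac.symm hae hbe.symm hbc hn4,
    R.isType1 hc ha hd hb hcd hab hac.symm had hbd.symm hbc hn2⟩

/-- The vertices `a`, `b` are adjacent to `c`, `d`, `e`, and there are no triangles. -/
lemma isListed_of_completeBipartite {a b c d e : V}
    (hnt : ∀ x ∈ ({u, v}ᶜ : Set V), ∀ y ∈ ({u, v}ᶜ : Set V), ∀ z ∈ ({u, v}ᶜ : Set V),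
      Φ.graph.Adj x y → Φ.graph.Adj y z → ¬ Φ.graph.Adj z x)
    (ha : a ∈ ({u, v}ᶜ : Set V)) (hb : b ∈ ({u, v}ᶜ : Set V)) (hc : c ∈ ({u, v}ᶜ : Set V))
    (hd : d ∈ ({u, v}ᶜ : Set V)) (he : e ∈ ({u, v}ᶜ : Set V)) (hac : Φ.graph.Adj a c)
    (hbc : Φ.graph.Adj b c) (had : Φ.graph.Adj a d) (hbd : Φ.graph.Adj b d)
    (hae : Φ.graph.Adj a e) (hbe : Φ.graph.Adj b e) (hab : a ≠ b) (hcd : c ≠ d) (hce : c ≠ e)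
    (hde : d ≠ e) : Φ.IsListed := by
  classical
  have hall : ∀ z ∈ ({u, v}ᶜ : Set V), z ∈ [c, a, d, b, e] := by
    intro z hz
    by_contra hn
    simp only [List.mem_cons, List.not_mem_nil, or_false, not_or] at hn
    have hS : Φ.graph.CyclomaticAtLeast {e, d, b, c, a} 2 :=
      ((((cyclomaticAtLeast_singleton a).insert_one (w := c) (by simp) hac.symm).insert_one
        (w := b) (a := c) (by simp) hbc).insert_two (w := d)
        (by simp [hbd.ne', hcd.symm, had.ne']) (by simp) (by simp) hab had.symm
        hbd.symm).insert_two (w := e) (by simp [hde.symm, hbe.ne', hce.symm, hae.ne'])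
        (by simp) (by simp) hab hae.symm hbe.symm
    have hzS : z ∉ ({e, d, b, c, a} : Finset V) := by simp [hn]
    -- Without triangles, a vertex adjacent to `a` shares the neighbours of `c`, hence is adjacent
    -- to `b`; one adjacent to `c` shares those of `a`, hence is adjacent to `d`. Either way two
    -- edges are added to `K_{2,3}`, whose cyclomatic number is 2.
    have hS' : Φ.graph.CyclomaticAtLeast {z, e, d, b, c, a} 3 := by
      rcases R.adj_or_adj ha hc hz hac with h | h
      · exact hS.insert_two hzS (by simp) (by simp) hab h
          (R.adj_of_path hc ha hz hb h hac hbc.symm (fun h' => hnt c hc a ha z hz hac.symm h.symm h'))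
      · exact hS.insert_two hzS (by simp) (by simp) hcd h
          (R.adj_of_path ha hc hz hd h hac.symm had (fun h' => hnt a ha c hc z hz hac h.symm h'))
    have := R.cyclomatic_le_two hS' ha hc (by simp) (by simp) hac
    omega
  obtain ⟨t, ht, hut⟩ := R.exists_adj
  have htl := hall t ht
  simp only [List.mem_cons, List.not_mem_nil, or_false] at htl
  rcases htl with rfl | rfl | rfl | rfl | rfl
  · exact R.isListed_of_completeBipartite_of_adj_side_three ha hb hc hd he hac hbc had hbd hae hbe
      hab hcd hce hde hall hut
  · exact R.isListed_of_completeBipartite_of_adj_side_two ha hb hc hd he hac hbc had hbd hae hbe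
      hab hcd hce hde hall hut
  · exact R.isListed_of_completeBipartite_of_adj_side_three ha hb hd hc he had hbd hac hbc hae hbe
      hab hcd.symm hde hce
      (fun z hz => by have := hall z hz; simp only [List.mem_cons] at this ⊢; tauto) hut
  · exact R.isListed_of_completeBipartite_of_adj_side_two hb ha hc hd he hbc hac hbd had hbe hae
      hab.symm hcd hce hde
      (fun z hz => by have := hall z hz; simp only [List.mem_cons] at this ⊢; tauto) hut
  · exact R.isListed_of_completeBipartite_of_adj_side_three ha hb he hd hc hae hbe had hbd hac hbc
      hab hde.symm hce.symm hcd.symm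
      (fun z hz => by have := hall z hz; simp only [List.mem_cons] at this ⊢; tauto) hut

end QuatGainGraph.IsReduction

/-! ### The remaining graph is a star; end of the classification -/

namespace QuatGainGraph

namespace IsReduction

open SimpleGraph (cyclomaticAtLeast_singleton)

variable {V : Type*} [Finite V] {Φ : QuatGainGraph V} {u v : V} (R : Φ.IsReduction u v)
include R

omit [Finite V] in
/-- Two leaves of the star with centre `c` that are not adjacent to `u` are equal. -/
lemma eq_of_star {c : V} (hc : c ∈ ({u, v}ᶜ : Set V))
    (hstar : ∀ z ∈ ({u, v}ᶜ : Set V), z ≠ c → Φ.graph.Adj z c)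
    (hedge : ∀ y ∈ ({u, v}ᶜ : Set V), ∀ z ∈ ({u, v}ᶜ : Set V), Φ.graph.Adj y z → y = c ∨ z = c)
    {y z : V} (hy : y ∈ ({u, v}ᶜ : Set V)) (hz : z ∈ ({u, v}ᶜ : Set V)) (hyc : y ≠ c)
    (hzc : z ≠ c) (huy : ¬ Φ.graph.Adj u y) (huz : ¬ Φ.graph.Adj u z) : y = z := by
  -- Such a leaf is pendant in the whole graph, so two of them would be twins.
  have key : ∀ y ∈ ({u, v}ᶜ : Set V), y ≠ c → ¬ Φ.graph.Adj u y → Φ.PendantAt c y := by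
    intro y hy hyc huy
    ext w
    rw [SimpleGraph.mem_neighborSet, Set.mem_singleton_iff]
    refine ⟨fun hyw => ?_, ?_⟩
    · by_cases hw : w ∈ ({u, v}ᶜ : Set V)
      · exact (hedge y hy w hw hyw).resolve_left hyc
      · simp only [Set.mem_compl_iff, not_not] at hw
        rcases hw with rfl | rfl
        · exact absurd hyw.symm huy
        · simp [R.pendant.adj_iff.1 hyw.symm] at hy
    · rintro rfl
      exact hstar y hy hyc
  exact R.leaf_unique (key y hy hyc huy) (key z hz hzc huz)

/-- Here `u`, `c`, `a`, `b` form a diamond with chord `uc`. A further neighbour of `u` would give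
cyclomatic number 3, so at most one more leaf exists, pendant at `c`; its absence or presence
distinguishes the two graphs. -/
lemma isListed_of_star_of_adj_center {c a b : V} (hc : c ∈ ({u, v}ᶜ : Set V))
    (hstar : ∀ z ∈ ({u, v}ᶜ : Set V), z ≠ c → Φ.graph.Adj z c)
    (hedge : ∀ y ∈ ({u, v}ᶜ : Set V), ∀ z ∈ ({u, v}ᶜ : Set V), Φ.graph.Adj y z → y = c ∨ z = c)
    (ha : a ∈ ({u, v}ᶜ : Set V)) (hb : b ∈ ({u, v}ᶜ : Set V)) (hac : a ≠ c) (hbc : b ≠ c)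
    (hab : a ≠ b) (huc : Φ.graph.Adj u c) (hua : Φ.graph.Adj u a) (hub : Φ.graph.Adj u b) :
    Φ.IsListed := by
  classical
  have h1 := hstar a ha hac
  have h2 := hstar b hb hbc
  have hnadj : ∀ z ∈ ({u, v}ᶜ : Set V), z ∉ [a, b, c] → ¬ Φ.graph.Adj u z := by
    intro z hz hn huz
    simp only [List.mem_cons, List.not_mem_nil, or_false, not_or] at hn
    have hS : Φ.graph.CyclomaticAtLeast {z, b, a, u, c} 3 :=
      ((((cyclomaticAtLeast_singleton c).insert_one (w := u) (by simp) huc).insert_two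
        (w := a) (by simp [hac, hua.ne']) (by simp) (by simp) huc.ne hua.symm h1).insert_two
        (w := b) (by simp [hbc, hub.ne', hab.symm]) (by simp) (by simp) huc.ne hub.symm
        h2).insert_two (w := z) (by simp [hn, huz.ne']) (by simp) (by simp) huc.ne huz.symm
        (hstar z hz hn.2.2)
    have := R.cyclomatic_le_two hS ha hc (by simp) (by simp) h1
    omega
  by_cases hall : ∀ z ∈ ({u, v}ᶜ : Set V), z ∈ [a, b, c]
  · obtain ⟨g, -⟩ := graphOfEdges.exists_iso R.card_edges graph13 rfl (by decide)
      ![a, u, b, c, v] (l := [a, u, b, c, v]) rfl (by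
        have := R.nodup_append (l := [a, b, c]) (by simp [hac, hbc, hab])
          (by simp only [List.forall_mem_cons]; exact ⟨ha, hb, hc, by simp⟩)
        refine (List.Perm.nodup_iff ?_).1 this
        exact .cons a (List.perm_append_comm (l₁ := [b, c]) (l₂ := [u]) |>.append_right [v]))
      (fun z => by
        have := mem_append hall z
        simp only [List.mem_append, List.mem_cons] at this ⊢
        tauto)
      (by simpa using ⟨hua.symm, hub, h2, h1.symm, huc, R.pendant.adj.symm⟩)
    exact .inr <| .inl ⟨g⟩
  · push Not at hall
    obtain ⟨d, hd, hdn⟩ := hall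
    have hud := hnadj d hd hdn
    have hall : ∀ z ∈ ({u, v}ᶜ : Set V), z ∈ [a, b, c, d] := by
      intro z hz
      by_contra hzn
      simp only [List.mem_cons, List.not_mem_nil, or_false, not_or] at hzn hdn
      exact hzn.2.2.2 (R.eq_of_star hc hstar hedge hz hd hzn.2.2.1 hdn.2.2
        (hnadj z hz (by simp [hzn])) hud)
    simp only [List.mem_cons, List.not_mem_nil, or_false, not_or] at hdn
    obtain ⟨g, -⟩ := graphOfEdges.exists_iso R.card_edges graph14 rfl (by decide)
      ![a, u, b, c, v, d] (l := [a, u, b, c, v, d]) rfl (by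
        have := R.nodup_append (l := [a, b, c, d])
          (by simp [hac, hbc, hab, Ne.symm hdn.1, Ne.symm hdn.2.1, Ne.symm hdn.2.2])
          (by simp only [List.forall_mem_cons]; exact ⟨ha, hb, hc, hd, by simp⟩)
        refine (List.Perm.nodup_iff ?_).1 this
        exact .cons a ((List.perm_append_comm (l₁ := [b, c, d]) (l₂ := [u])
          |>.append_right [v]).trans (List.perm_append_comm (l₁ := [d]) (l₂ := [v])
          |>.append_left [u, b, c])))
      (fun z => by
        have := mem_append hall z
        simp only [List.mem_append, List.mem_cons] at this ⊢
        tauto)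
      (by simpa using ⟨hua.symm, hub, h2, h1.symm, huc, R.pendant.adj.symm,
        (hstar d hd hdn.2.2).symm⟩)
    exact .inr <| .inr <| .inl ⟨g⟩

/-- Here `u` and `c` are the two vertices of degree 3 in a `K_{2,3}` with other part `a`, `b`, `d`.
Again at most one more leaf exists, pendant at `c`. -/
lemma isListed_of_star_of_not_adj_center {c a b d : V} (hc : c ∈ ({u, v}ᶜ : Set V))
    (hstar : ∀ z ∈ ({u, v}ᶜ : Set V), z ≠ c → Φ.graph.Adj z c)
    (hedge : ∀ y ∈ ({u, v}ᶜ : Set V), ∀ z ∈ ({u, v}ᶜ : Set V), Φ.graph.Adj y z → y = c ∨ z = c)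
    (ha : a ∈ ({u, v}ᶜ : Set V)) (hb : b ∈ ({u, v}ᶜ : Set V)) (hd : d ∈ ({u, v}ᶜ : Set V))
    (hac : a ≠ c) (hbc : b ≠ c) (hdc : d ≠ c) (hab : a ≠ b) (had : a ≠ d) (hbd : b ≠ d)
    (hua : Φ.graph.Adj u a) (hub : Φ.graph.Adj u b) (hud : Φ.graph.Adj u d) :
    Φ.IsListed := by
  classical
  have h1 := hstar a ha hac
  have h2 := hstar b hb hbc
  have h3 := hstar d hd hdc
  have huc : u ≠ c := by
    rintro rfl
    simp at hc
  have hnadj : ∀ z ∈ ({u, v}ᶜ : Set V), z ∉ [a, b, c, d] → ¬ Φ.graph.Adj u z := by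
    intro z hz hn huz
    simp only [List.mem_cons, List.not_mem_nil, or_false, not_or] at hn
    have hS : Φ.graph.CyclomaticAtLeast {z, d, b, u, a, c} 3 :=
      (((((cyclomaticAtLeast_singleton c).insert_one (w := a) (by simp) h1).insert_one
        (w := u) (a := a) (by simp) hua).insert_two
        (w := b) (by simp [hbc, hub.ne', hab.symm]) (by simp) (by simp) huc hub.symm
        h2).insert_two (w := d) (by simp [hdc, hud.ne', hbd.symm, had.symm]) (by simp) (by simp)
        huc hud.symm h3).insert_two (w := z) (by simp [hn, huz.ne']) (by simp) (by simp) huc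
        huz.symm (hstar z hz hn.2.2.1)
    have := R.cyclomatic_le_two hS ha hc (by simp) (by simp) h1
    omega
  by_cases hall : ∀ z ∈ ({u, v}ᶜ : Set V), z ∈ [a, b, c, d]
  · obtain ⟨g, -⟩ := graphOfEdges.exists_iso R.card_edges graph19 rfl (by decide)
      ![a, u, b, c, d, v] (l := [a, u, b, c, d, v]) rfl (by
        have := R.nodup_append (l := [a, b, c, d]) (by simp [hac, hbc, hab, had, hbd, hdc.symm])
          (by simp only [List.forall_mem_cons]; exact ⟨ha, hb, hc, hd, by simp⟩)
        refine (List.Perm.nodup_iff ?_).1 this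
        exact .cons a (List.perm_append_comm (l₁ := [b, c, d]) (l₂ := [u]) |>.append_right [v]))
      (fun z => by
        have := mem_append hall z
        simp only [List.mem_append, List.mem_cons] at this ⊢
        tauto)
      (by simpa using ⟨hua.symm, hub, h2, h1.symm, hud, h3.symm, R.pendant.adj.symm⟩)
    exact .inr <| .inr <| .inr <| .inr <| .inr <| .inr <| .inr <| .inl ⟨g⟩
  · push Not at hall
    obtain ⟨e, he, hen⟩ := hall
    have hue := hnadj e he hen
    have hall : ∀ z ∈ ({u, v}ᶜ : Set V), z ∈ [a, b, c, d, e] := by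
      intro z hz
      by_contra hzn
      simp only [List.mem_cons, List.not_mem_nil, or_false, not_or] at hzn hen
      exact hzn.2.2.2.2 (R.eq_of_star hc hstar hedge hz he hzn.2.2.1 hen.2.2.1
        (hnadj z hz (by simp [hzn])) hue)
    simp only [List.mem_cons, List.not_mem_nil, or_false, not_or] at hen
    obtain ⟨g, -⟩ := graphOfEdges.exists_iso R.card_edges graph20 rfl (by decide)
      ![a, u, b, c, d, v, e] (l := [a, u, b, c, d, v, e]) rfl (by
        have := R.nodup_append (l := [a, b, c, d, e])
          (by simp [hac, hbc, hab, had, hbd, hdc.symm, Ne.symm hen.1, Ne.symm hen.2.1,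
            Ne.symm hen.2.2.1, Ne.symm hen.2.2.2])
          (by simp only [List.forall_mem_cons]; exact ⟨ha, hb, hc, hd, he, by simp⟩)
        refine (List.Perm.nodup_iff ?_).1 this
        exact .cons a ((List.perm_append_comm (l₁ := [b, c, d, e]) (l₂ := [u])
          |>.append_right [v]).trans (List.perm_append_comm (l₁ := [e]) (l₂ := [v])
          |>.append_left [u, b, c, d])))
      (fun z => by
        have := mem_append hall z
        simp only [List.mem_append, List.mem_cons] at this ⊢
        tauto)
      (by simpa using ⟨hua.symm, hub, h2, h1.symm, hud, h3.symm, R.pendant.adj.symm,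
        (hstar e he hen.2.2.1).symm⟩)
    exact .inr <| .inr <| .inr <| .inr <| .inr <| .inr <| .inr <| .inr <| .inl ⟨g⟩

/-- The vertices other than `u` and `v` form a star with centre `c`. -/
lemma isListed_of_star {c : V} (hc : c ∈ ({u, v}ᶜ : Set V))
    (hstar : ∀ z ∈ ({u, v}ᶜ : Set V), z ≠ c → Φ.graph.Adj z c)
    (hedge : ∀ y ∈ ({u, v}ᶜ : Set V), ∀ z ∈ ({u, v}ᶜ : Set V), Φ.graph.Adj y z → y = c ∨ z = c) :
    Φ.IsListed := by
  classical
  have := Fintype.ofFinite V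
  have hcuv : c ≠ u ∧ c ≠ v := by simpa using hc
  set F : Finset (Sym2 V) := ({u, v, c} : Finset V)ᶜ.image fun z => s(z, c) with hFdef
  have hF : ∀ x ∈ ({u, v}ᶜ : Set V), ∀ y ∈ ({u, v}ᶜ : Set V), Φ.graph.Adj x y → s(x, y) ∈ F := by
    intro x hx y hy hxy
    simp only [Set.mem_compl_iff, Set.mem_insert_iff, Set.mem_singleton_iff, not_or] at hx hy
    rcases hedge x (by simp [hx]) y (by simp [hy]) hxy with rfl | rfl
    · exact Finset.mem_image.2 ⟨y, by simp [hy, hxy.ne'], Sym2.eq_swap⟩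
    · exact Finset.mem_image.2 ⟨x, by simp [hx, hxy.ne], rfl⟩
  -- A star on `Nat.card V - 2` vertices has `Nat.card V - 3` edges, which leaves room to find three
  -- distinct neighbours of `u`.
  have hFcard : F.card + 3 ≤ Nat.card V := by
    have h1 : F.card ≤ ({u, v, c} : Finset V)ᶜ.card := Finset.card_image_le
    have h2 : ({u, v, c} : Finset V).card = 3 :=
      Finset.card_eq_three.2 ⟨u, v, c, R.pendant.ne, hcuv.1.symm, hcuv.2.symm, rfl⟩
    have h3 := Finset.card_le_univ ({u, v, c} : Finset V)
    rw [Finset.card_compl] at h1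
    rw [Nat.card_eq_fintype_card]
    omega
  obtain ⟨t₁, h₁, hu₁, -⟩ := R.exists_adj_notMem hF ∅ (by rw [Finset.card_empty]; omega)
  obtain ⟨t₂, h₂, hu₂, hne₂⟩ := R.exists_adj_notMem hF {t₁} (by rw [Finset.card_singleton]; omega)
  obtain ⟨t₃, h₃, hu₃, hne₃⟩ := R.exists_adj_notMem hF {t₁, t₂} (by
    have := Finset.card_le_two (a := t₁) (b := t₂)
    omega)
  simp only [Finset.mem_singleton, Finset.mem_insert, not_or] at hne₂ hne₃
  by_cases hc₁ : t₁ = c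
  · subst hc₁
    exact R.isListed_of_star_of_adj_center hc hstar hedge h₂ h₃ hne₂ hne₃.1 (Ne.symm hne₃.2)
      hu₁ hu₂ hu₃
  by_cases hc₂ : t₂ = c
  · subst hc₂
    exact R.isListed_of_star_of_adj_center hc hstar hedge h₁ h₃ hc₁ hne₃.2 (Ne.symm hne₃.1)
      hu₂ hu₁ hu₃
  by_cases hc₃ : t₃ = c
  · subst hc₃
    exact R.isListed_of_star_of_adj_center hc hstar hedge h₁ h₂ hc₁ hc₂ (Ne.symm hne₂)
      hu₃ hu₁ hu₂
  exact R.isListed_of_star_of_not_adj_center hc hstar hedge h₁ h₂ h₃ hc₁ hc₂ hc₃ (Ne.symm hne₂)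
    (Ne.symm hne₃.1) (Ne.symm hne₃.2) hu₁ hu₂ hu₃

/-- There are no triangles, and `a`, `y`, `x`, `b` is a path on four vertices. -/
lemma isListed_of_path {x y a b : V}
    (hnt : ∀ x ∈ ({u, v}ᶜ : Set V), ∀ y ∈ ({u, v}ᶜ : Set V), ∀ z ∈ ({u, v}ᶜ : Set V),
      Φ.graph.Adj x y → Φ.graph.Adj y z → ¬ Φ.graph.Adj z x)
    (hx : x ∈ ({u, v}ᶜ : Set V)) (hy : y ∈ ({u, v}ᶜ : Set V)) (ha : a ∈ ({u, v}ᶜ : Set V))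
    (hb : b ∈ ({u, v}ᶜ : Set V)) (hxy : Φ.graph.Adj x y) (hay : Φ.graph.Adj a y)
    (hbx : Φ.graph.Adj b x) (hax : a ≠ x) (hby : b ≠ y) : Φ.IsListed := by
  have hab : Φ.graph.Adj a b := R.adj_of_path hx hy ha hb hay hxy.symm hbx.symm
    (hnt x hx y hy a ha hxy hay.symm)
  by_cases hall : ∀ z ∈ ({u, v}ᶜ : Set V), z ∈ [x, y, a, b]
  · exact R.isListed_of_quadrangle hx hy ha hb hxy hay.symm hab hbx hax.symm hby.symm
      (fun h => hnt x hx y hy a ha hxy hay.symm h.symm)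
      (fun h => hnt y hy a ha b hb hay.symm hab h.symm) hall
  push Not at hall
  obtain ⟨w, hw, hn⟩ := hall
  simp only [List.mem_cons, List.not_mem_nil, or_false, not_or] at hn
  rcases R.adj_or_adj hx hy hw hxy with h | h
  · have hwa : Φ.graph.Adj w a := R.adj_of_path hy hx hw ha h hxy hay.symm
      (hnt y hy x hx w hw hxy.symm h.symm)
    exact R.isListed_of_completeBipartite hnt hx ha hy hb hw hxy hay hbx.symm hab h.symm hwa.symm
      hax.symm hby.symm (Ne.symm hn.2.1) (Ne.symm hn.2.2.2)
  · have hwb : Φ.graph.Adj w b := R.adj_of_path hx hy hw hb h hxy.symm hbx.symm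
      (hnt x hx y hy w hw hxy h.symm)
    exact R.isListed_of_completeBipartite hnt hy hb hx ha hw hxy.symm hbx hay.symm hab.symm h.symm
      hwb.symm hby.symm hax.symm (Ne.symm hn.1) (Ne.symm hn.2.2.1)

lemma isListed {x y : V} (hx : x ∈ ({u, v}ᶜ : Set V)) (hy : y ∈ ({u, v}ᶜ : Set V))
    (hxy : Φ.graph.Adj x y) : Φ.IsListed := by
  by_cases hnt : ∀ x ∈ ({u, v}ᶜ : Set V), ∀ y ∈ ({u, v}ᶜ : Set V), ∀ z ∈ ({u, v}ᶜ : Set V),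
      Φ.graph.Adj x y → Φ.graph.Adj y z → ¬ Φ.graph.Adj z x
  -- If `y` is the only neighbour of `x`, domination by the edge `xy` attaches every other vertex to
  -- `y`, and without triangles this is a star. If neither end of the edge is such a leaf, the edge
  -- is the middle of a path on four vertices.
  · have key : ∀ {x y}, x ∈ ({u, v}ᶜ : Set V) → y ∈ ({u, v}ᶜ : Set V) → Φ.graph.Adj x y →
        (∀ b ∈ ({u, v}ᶜ : Set V), Φ.graph.Adj b x → b = y) → Φ.IsListed := by
      intro x y hx hy hxy hb
      have hstar : ∀ z ∈ ({u, v}ᶜ : Set V), z ≠ y → Φ.graph.Adj z y := fun z hz hzy =>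
        (R.adj_or_adj hx hy hz hxy).resolve_left fun h => hzy (hb z hz h)
      refine R.isListed_of_star hy hstar fun z hz w hw hzw => ?_
      by_contra! hn
      exact hnt y hy z hz w hw (hstar z hz hn.1).symm hzw (hstar w hw hn.2)
    by_cases h1 : ∀ b ∈ ({u, v}ᶜ : Set V), Φ.graph.Adj b x → b = y
    · exact key hx hy hxy h1
    by_cases h2 : ∀ a ∈ ({u, v}ᶜ : Set V), Φ.graph.Adj a y → a = x
    · exact key hy hx hxy.symm h2
    push Not at h1 h2
    obtain ⟨b, hb, hbx, hby⟩ := h1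
    obtain ⟨a, ha, hay, hax⟩ := h2
    exact R.isListed_of_path hnt hx hy ha hb hxy hay hbx hax hby
  · push Not at hnt
    obtain ⟨p, hp, q, hq, r, hr, hpq, hqr, hrp⟩ := hnt
    exact R.isListed_of_triangle hp hq hr hpq hqr hrp

end IsReduction

variable {V : Type*} [Finite V] {Φ : QuatGainGraph V}

omit [Finite V] in
lemma PendantAt.isPendant {u v : V} (h : Φ.PendantAt u v) : Φ.graph.IsPendant v := by
  rw [SimpleGraph.IsPendant, h, Set.ncard_singleton]

/-- Absence of twins enters here: a vertex `z` adjacent to neither end of `xy` has no neighbour in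
`{u, v}ᶜ`, so connectedness makes it pendant at `u`, a twin of `v`. -/
lemma PendantAt.isReduction {u v : V} (h : Φ.PendantAt u v) (hb : Φ.graph.IsBicyclic)
    (ht : ¬ ∃ x y, Φ.graph.ArePendantTwins x y) (hr : Φ.rank = 4) : Φ.IsReduction u v := by
  have hleaf : ∀ {a x y}, Φ.PendantAt a x → Φ.PendantAt a y → x = y := by
    intro a x y hx hy
    by_contra hn
    exact ht ⟨x, y, hn, hx.isPendant, hy.isPendant, hx.trans hy.symm⟩
  refine ⟨hb.2, h, h.spannedBy_of_rank hr, ?_, hleaf, ?_⟩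
  · intro x y z hx hy hz hxy
    by_contra! hn
    have hz' : z ≠ u ∧ z ≠ v := by simpa using hz
    have hsub : ∀ w, Φ.graph.Adj z w → w = u := by
      intro w hzw
      by_contra hwu
      have hwv : w ≠ v := by
        rintro rfl
        exact hz'.1 (h.adj_iff.1 hzw.symm)
      exact (h.spannedBy_of_rank hr hx hy hxy).not_adj hz (by simp [hwu, hwv]) hn.1 hn.2 hzw
    obtain ⟨_, hmem, w, -, hzw⟩ := hb.1.exists_adj_notMem (S := {z}) rfl (b := v) (by
      simpa using hz'.2.symm)
    rw [Set.mem_singleton_iff.1 hmem] at hzw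
    have hzu : Φ.PendantAt u z := by
      ext w'
      rw [SimpleGraph.mem_neighborSet, Set.mem_singleton_iff]
      exact ⟨hsub w', fun hw' => by rw [hw', ← hsub w hzw]; exact hzw⟩
    exact hz'.2 (hleaf hzu h)
  · obtain ⟨x, hx, -⟩ := h.exists_adj_of_rank hr
    obtain ⟨c, hc, d, hd, hcd⟩ := hb.1.exists_adj_notMem (S := {u, v}) (a := u) (by simp) hx
    rcases hc with rfl | rfl
    · exact ⟨d, hd, hcd⟩
    · rw [h.adj_iff.1 hcd] at hd
      simp at hd

lemma isListed_of_rank_eq_four (hb : Φ.graph.IsBicyclic) (hp : ∃ v, Φ.graph.IsPendant v)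
    (ht : ¬ ∃ x y, Φ.graph.ArePendantTwins x y) (hr : Φ.rank = 4) : Φ.IsListed := by
  obtain ⟨v, hv⟩ := hp
  obtain ⟨u, hu⟩ := Set.ncard_eq_one.1 hv
  have h : Φ.PendantAt u v := hu
  obtain ⟨x, hx, y, hy, hxy⟩ := h.exists_adj_of_rank hr
  exact (h.isReduction hb ht hr).isListed hx hy hxy

end QuatGainGraph

/-! ### The converse: the listed graphs have rank 4 -/

namespace SimpleGraph

lemma Iso.neighborSet_eq {V W : Type*} {G : SimpleGraph V} {H : SimpleGraph W} (f : H ≃g G) (i : W) :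
    G.neighborSet (f i) = f '' H.neighborSet i := by
  ext a
  obtain ⟨j, rfl⟩ := f.surjective a
  rw [f.injective.mem_set_image, mem_neighborSet, mem_neighborSet, f.map_adj_iff]

/-- Stepping to a smaller neighbour until `r` is reached proves connectedness from a condition that
`decide` can check. -/
lemma Iso.isBicyclic {V : Type*} {G : SimpleGraph V} {n : ℕ} {H : SimpleGraph (Fin n)}
    [DecidableRel H.Adj] (f : H ≃g G) {r : Fin n} (hr : ∀ i, i ≠ r → ∃ j, j < i ∧ H.Adj i j)
    (hE : H.edgeFinset.card = n + 1) : G.IsBicyclic := by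
  constructor
  · refine f.connected_iff.1 ?_
    have hreach : ∀ i, H.Reachable i r := by
      intro i
      induction i using WellFoundedLT.induction with
      | _ i ih =>
        by_cases hi : i = r
        · rw [hi]
        · obtain ⟨j, hj, hij⟩ := hr i hi
          exact hij.reachable.trans (ih j hj)
    have : Nonempty (Fin n) := ⟨r⟩
    exact ⟨fun i j => (hreach i).trans (hreach j).symm⟩
  · rw [← Nat.card_coe_set_eq, ← Nat.card_congr f.mapEdgeSet, Nat.card_coe_set_eq,
      ← coe_edgeFinset, Set.ncard_coe_finset, hE, ← Nat.card_congr f.toEquiv, Nat.card_fin]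

end SimpleGraph

namespace QuatGainGraph

variable {V : Type*} {Φ : QuatGainGraph V}

/-- The identity of `SpannedBy` holds whenever one of the vertices is `x` or `y`. -/
lemma spannedBy_of_compl {s : Set V} {x y : V} (hxy : Φ.graph.Adj x y)
    (h : ∀ z ∈ s, z ≠ x → z ≠ y → ∀ w ∈ s, w ≠ x → w ≠ y → Φ.adjMatrix z w =
      Φ.adjMatrix z y * Φ.adjMatrix y x * Φ.adjMatrix x w +
        Φ.adjMatrix z x * Φ.adjMatrix x y * Φ.adjMatrix y w) : Φ.SpannedBy s x y := by
  intro z hz w hw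
  by_cases hzx : z = x
  · subst hzx
    rw [Φ.adjMatrix_self, Φ.adjMatrix_mul_symm hxy]
    simp
  by_cases hzy : z = y
  · subst hzy
    rw [Φ.adjMatrix_self, Φ.adjMatrix_mul_symm hxy.symm]
    simp
  by_cases hwx : w = x
  · subst hwx
    rw [Φ.adjMatrix_self, mul_assoc (Φ.adjMatrix z w), Φ.adjMatrix_mul_symm hxy]
    simp
  by_cases hwy : w = y
  · subst hwy
    rw [Φ.adjMatrix_self, mul_assoc (Φ.adjMatrix z w), Φ.adjMatrix_mul_symm hxy.symm]
    simp
  exact h z hz hzx hzy w hw hwx hwy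

/-- The matrix is Hermitian, so conjugation exchanges `z` and `w`; one order of each pair is enough.
-/
lemma spanned_swap {x y z w : V} (h : Φ.adjMatrix z w =
      Φ.adjMatrix z y * Φ.adjMatrix y x * Φ.adjMatrix x w +
        Φ.adjMatrix z x * Φ.adjMatrix x y * Φ.adjMatrix y w) :
    Φ.adjMatrix w z = Φ.adjMatrix w y * Φ.adjMatrix y x * Φ.adjMatrix x z +
      Φ.adjMatrix w x * Φ.adjMatrix x y * Φ.adjMatrix y z := by
  have := congrArg star h
  simp only [star_add, star_mul, star_adjMatrix] at this
  rw [this, add_comm]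
  simp only [mul_assoc]

lemma IsType4.spanned {x y z : V} (h : Φ.IsType4 [x, y, z]) : Φ.adjMatrix z z =
    Φ.adjMatrix z y * Φ.adjMatrix y x * Φ.adjMatrix x z +
      Φ.adjMatrix z x * Φ.adjMatrix x y * Φ.adjMatrix y z := by
  rw [(isType4_triple_iff.1 h).2, Φ.adjMatrix_self]

lemma IsType1.spanned {x y z w : V} (h : Φ.IsType1 [x, y, z, w]) (hn : ¬ Φ.graph.Adj z x) :
    Φ.adjMatrix z w = Φ.adjMatrix z y * Φ.adjMatrix y x * Φ.adjMatrix x w +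
      Φ.adjMatrix z x * Φ.adjMatrix x y * Φ.adjMatrix y w := by
  rw [Φ.adjMatrix_of_not_adj hn, zero_mul, zero_mul, add_zero]
  exact (isType1_quadruple_iff.1 h).2

/-- Properties of the underlying graph, and the gain conditions at the listed pairs of vertices,
which imply rank 4. The vertices `x` and `y` are the adjacent ones whose rows, together with those
of the pendant vertex `v` and its neighbour `u`, span all rows. -/
lemma isBicyclic_and_rank_eq_four_of_iso [Finite V] {n : ℕ} {H : SimpleGraph (Fin n)} [DecidableRel H.Adj]
    (f : H ≃g Φ.graph) (u v x y r : Fin n) (L : List (Fin n × Fin n))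
    (hE : H.edgeFinset.card = n + 1) (hr : ∀ i, i ≠ r → ∃ j, j < i ∧ H.Adj i j)
    (htwins : ∀ i j k, (∀ l, H.Adj i l ↔ l = k) → (∀ l, H.Adj j l ↔ l = k) → i = j)
    (hpend : ∀ i, H.Adj v i ↔ i = u)
    (hxy : H.Adj x y ∧ x ≠ u ∧ x ≠ v ∧ y ≠ u ∧ y ≠ v)
    (hL : ∀ i j, i ∈ [u, v, x, y] ∨ j ∈ [u, v, x, y] ∨ (i, j) ∈ L ∨ (j, i) ∈ L ∨
      (¬ H.Adj i j ∧ ¬ (H.Adj i y ∧ H.Adj x j) ∧ ¬ (H.Adj i x ∧ H.Adj y j)))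
    (hs : ∀ p ∈ L, Φ.adjMatrix (f p.1) (f p.2) =
      Φ.adjMatrix (f p.1) (f y) * Φ.adjMatrix (f y) (f x) * Φ.adjMatrix (f x) (f p.2) +
        Φ.adjMatrix (f p.1) (f x) * Φ.adjMatrix (f x) (f y) * Φ.adjMatrix (f y) (f p.2)) :
    Φ.graph.IsBicyclic ∧ (∃ v, Φ.graph.IsPendant v) ∧
      (¬ ∃ x y, Φ.graph.ArePendantTwins x y) ∧ Φ.rank = 4 := by
  have hN : ∀ {i k}, H.neighborSet i = {k} ↔ ∀ l, H.Adj i l ↔ l = k := by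
    intro i k
    rw [Set.ext_iff]
    rfl
  have hP : Φ.PendantAt (f u) (f v) := by
    rw [PendantAt, f.neighborSet_eq, hN.2 hpend, Set.image_singleton]
  refine ⟨f.isBicyclic hr hE, ⟨_, hP.isPendant⟩, ?_, ?_⟩
  · rintro ⟨a, b, hab, ha, -, heq⟩
    obtain ⟨i, rfl⟩ := f.surjective a
    obtain ⟨j, rfl⟩ := f.surjective b
    rw [SimpleGraph.IsPendant, f.neighborSet_eq, Set.ncard_image_of_injective _ f.injective,
      Set.ncard_eq_one] at ha
    obtain ⟨k, hk⟩ := ha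
    rw [f.neighborSet_eq, f.neighborSet_eq, f.injective.image_injective.eq_iff] at heq
    exact hab (congrArg f (htwins i j k (hN.1 hk) (hN.1 (heq ▸ hk))))
  · obtain ⟨hxy, hxu, hxv, hyu, hyv⟩ := hxy
    refine hP.rank_eq_four (x := f x) (y := f y) (by simp [hxu, hxv]) (by simp [hyu, hyv])
      (f.map_adj_iff.2 hxy) (spannedBy_of_compl (f.map_adj_iff.2 hxy) ?_)
    intro z hz hzx hzy w hw hwx hwy
    obtain ⟨i, rfl⟩ := f.surjective z
    obtain ⟨j, rfl⟩ := f.surjective w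
    simp only [Set.mem_compl_iff, Set.mem_insert_iff, Set.mem_singleton_iff, not_or,
      f.injective.eq_iff, f.injective.ne_iff] at hz hzx hzy hw hwx hwy
    rcases hL i j with h | h | h | h | ⟨h1, h2, h3⟩
    · simp_all
    · simp_all
    · exact hs _ h
    · exact spanned_swap (hs _ h)
    -- At an unlisted pair all three terms of the identity contain a zero entry.
    · rw [Φ.adjMatrix_of_not_adj (f.map_adj_iff.not.2 h1)]
      have e1 : Φ.adjMatrix (f i) (f y) * Φ.adjMatrix (f y) (f x) * Φ.adjMatrix (f x) (f j) = 0 := by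
        rcases not_and_or.1 h2 with h | h <;>
          rw [Φ.adjMatrix_of_not_adj (f.map_adj_iff.not.2 h)] <;> simp
      have e2 : Φ.adjMatrix (f i) (f x) * Φ.adjMatrix (f x) (f y) * Φ.adjMatrix (f y) (f j) = 0 := by
        rcases not_and_or.1 h3 with h | h <;>
          rw [Φ.adjMatrix_of_not_adj (f.map_adj_iff.not.2 h)] <;> simp
      rw [e1, e2, add_zero]

/-- The numbers passed in each case are `u`, `v`, the edge `x`, `y` and the root 0, and the list
holds the pairs where the identity has content: a diagonal pair for a triangle, an off-diagonal one
for a quadrangle. It is empty when deleting `u` and `v` leaves a star. -/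
lemma IsListed.isBicyclic_and_rank_eq_four [Finite V] (h : Φ.IsListed) :
    Φ.graph.IsBicyclic ∧ (∃ v, Φ.graph.IsPendant v) ∧
      (¬ ∃ x y, Φ.graph.ArePendantTwins x y) ∧ Φ.rank = 4 := by
  rcases h with ⟨f, h4⟩ | ⟨⟨f⟩⟩ | ⟨⟨f⟩⟩ | ⟨f, h4, h1⟩ | ⟨f, h4, h1⟩ | ⟨f, h1⟩ | ⟨f, h1⟩ | ⟨⟨f⟩⟩ |
    ⟨⟨f⟩⟩ | ⟨f, h1, h1'⟩ | ⟨f, h1, h1'⟩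
  · refine isBicyclic_and_rank_eq_four_of_iso f 3 4 0 1 0 [(2, 2)] (by decide) (by decide) (by decide) (by decide) (by decide)
      (by decide) (List.forall_mem_singleton.2 h4.spanned)
  · exact isBicyclic_and_rank_eq_four_of_iso f 1 4 0 3 0 [] (by decide) (by decide) (by decide) (by decide) (by decide)
      (by decide) (by simp)
  · exact isBicyclic_and_rank_eq_four_of_iso f 1 4 0 3 0 [] (by decide) (by decide) (by decide) (by decide) (by decide)
      (by decide) (by simp)
  · exact isBicyclic_and_rank_eq_four_of_iso f 4 5 0 1 0 [(2, 3), (3, 3)] (by decide) (by decide) (by decide) (by decide)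
      (by decide) (by decide) (List.forall_mem_cons.2
        ⟨h1.spanned (f.map_adj_iff.not.2 (by decide)), List.forall_mem_singleton.2 h4.spanned⟩)
  · exact isBicyclic_and_rank_eq_four_of_iso f 4 5 0 1 0 [(2, 3), (3, 3)] (by decide) (by decide) (by decide) (by decide)
      (by decide) (by decide) (List.forall_mem_cons.2
        ⟨h1.spanned (f.map_adj_iff.not.2 (by decide)), List.forall_mem_singleton.2 h4.spanned⟩)
  · exact isBicyclic_and_rank_eq_four_of_iso f 4 5 0 1 0 [(2, 3)] (by decide) (by decide) (by decide) (by decide)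
      (by decide) (by decide) (List.forall_mem_singleton.2
        (h1.spanned (f.map_adj_iff.not.2 (by decide))))
  · exact isBicyclic_and_rank_eq_four_of_iso f 4 5 0 1 0 [(2, 3)] (by decide) (by decide) (by decide) (by decide)
      (by decide) (by decide) (List.forall_mem_singleton.2
        (h1.spanned (f.map_adj_iff.not.2 (by decide))))
  · exact isBicyclic_and_rank_eq_four_of_iso f 1 5 0 3 0 [] (by decide) (by decide) (by decide) (by decide) (by decide)
      (by decide) (by simp)
  · exact isBicyclic_and_rank_eq_four_of_iso f 1 5 0 3 0 [] (by decide) (by decide) (by decide) (by decide) (by decide)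
      (by decide) (by simp)
  · exact isBicyclic_and_rank_eq_four_of_iso f 5 6 0 1 0 [(4, 3), (2, 3)] (by decide) (by decide) (by decide) (by decide)
      (by decide) (by decide) (List.forall_mem_cons.2
        ⟨h1.spanned (f.map_adj_iff.not.2 (by decide)), List.forall_mem_singleton.2
          (h1'.spanned (f.map_adj_iff.not.2 (by decide)))⟩)
  · exact isBicyclic_and_rank_eq_four_of_iso f 5 6 0 1 0 [(4, 3), (2, 3)] (by decide) (by decide) (by decide) (by decide)
      (by decide) (by decide) (List.forall_mem_cons.2
        ⟨h1.spanned (f.map_adj_iff.not.2 (by decide)), List.forall_mem_singleton.2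
          (h1'.spanned (f.map_adj_iff.not.2 (by decide)))⟩)

end QuatGainGraph

theorem theorem4p5 {V : Type*} [Finite V] (Φ : QuatGainGraph V) :
    (Φ.graph.IsBicyclic ∧ (∃ v, Φ.graph.IsPendant v) ∧
        (¬ ∃ x y, Φ.graph.ArePendantTwins x y) ∧ Φ.rank = 4) ↔
      ((∃ f : graph12 ≃g Φ.graph, Φ.IsType4 [f 0, f 1, f 2]) ∨
        Nonempty (graph13 ≃g Φ.graph) ∨
        Nonempty (graph14 ≃g Φ.graph) ∨
        (∃ f : graph15 ≃g Φ.graph, Φ.IsType4 [f 0, f 1, f 3] ∧ Φ.IsType1 [f 0, f 1, f 2, f 3]) ∨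
        (∃ f : graph16 ≃g Φ.graph, Φ.IsType4 [f 0, f 1, f 3] ∧ Φ.IsType1 [f 0, f 1, f 2, f 3]) ∨
        (∃ f : graph17 ≃g Φ.graph, Φ.IsType1 [f 0, f 1, f 2, f 3]) ∨
        (∃ f : graph18 ≃g Φ.graph, Φ.IsType1 [f 0, f 1, f 2, f 3]) ∨
        Nonempty (graph19 ≃g Φ.graph) ∨
        Nonempty (graph20 ≃g Φ.graph) ∨
        (∃ f : graph21 ≃g Φ.graph,
          Φ.IsType1 [f 0, f 1, f 4, f 3] ∧ Φ.IsType1 [f 0, f 1, f 2, f 3]) ∨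
        (∃ f : graph22 ≃g Φ.graph,
          Φ.IsType1 [f 0, f 1, f 4, f 3] ∧ Φ.IsType1 [f 0, f 1, f 2, f 3])) := by
  exact ⟨fun ⟨hb, hp, ht, hr⟩ => QuatGainGraph.isListed_of_rank_eq_four hb hp ht hr,
    QuatGainGraph.IsListed.isBicyclic_and_rank_eq_four⟩
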